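/- **Lemma (Interval Dichotomy).** Let $\mathcal C_f\subset(0,1)$ be a finite set and let $f:[0,1]\setminus\mathcal C_f\to[0,1]$ be a $C^3$ local diffeomorphism (that is, $f$ is $C^3$ with $f'\neq 0$ everywhere, one-sided derivatives being used at $0$ and $1$) with negative Schwarzian derivative, $Sf=\frac{f'''}{f'}-\frac32\big(\frac{f''}{f'}\big)^2<0$, on $[0,1]\setminus\mathcal C_f$. For $x\in[0,1]$ whose forward orbit never meets $\mathcal C_f$, let $\omega_f(x)$ be the set of accumulation points of the sequence $(f^n(x))_{n\ge 0}$; if the forward orbit of $x$ meets $\mathcal C_f$, put $\omega_f(x)=\emptyset$. The basin of a set $A\subset[0,1]$ is $\beta_f(A)=\{x\in[0,1]:\omega_f(x)\subset A\}$. A compact set $A\subset[0,1]$ is an attractor if $\operatorname{Leb}(\beta_f(A))>0$ and no closed $A'\subsetneq A$ has $\beta_f(A')=\beta_f(A)$ up to a Lebesgue null set. Let $f$ act on the lateral points $p-\mathrm i$ ($0<p\le1$) and $p+\mathrm i$ ($0\le p<1$) by $$f(p-\mathrm i)=\lim_{x\uparrow p}f(x)-\mathrm i\lim_{x\uparrow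 p}\tfrac{f'(x)}{|f'(x)|},\qquad f(p+\mathrm i)=\lim_{x\downarrow p}f(x)+\mathrm i\lim_{x\downarrow p}\tfrac{f'(x)}{|f'(x)|}.$$ A periodic-like attractor is an attractor of the form $A=\{\operatorname{Re}f^j(\alpha):j\ge0\}$, where $\alpha$ is a lateral point with $f^n(\alpha)=\alpha$ for some $n\ge1$. Let $\mathbb B_0(f)$ be the union of the basins of all periodic-like attractors. Let $I=(a,b)\subset[0,1]$ be an open interval that contains none of the points $\operatorname{Re}f^n(c\pm\mathrm i)$ with $c\in\mathcal C_f$ and $n\ge1$, and suppose that $\operatorname{Leb}(I\setminus\mathbb B_0(f))>0$. Then either $\omega_f(x)\cap I=\emptyset$ for Lebesgue almost every $x\in I\setminus\mathbb B_0(f)$, or $\omega_f(x)\supset I$ for Lebesgue almost every $x\in I$. -/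

import Mathlib

open Set Filter Topology MeasureTheory

noncomputable section

namespace IntervalDynamics

/-- The domain `[0,1] ∖ C` of a piecewise map with exceptional set `C`. -/
def dom (C : Set ℝ) : Set ℝ := Icc 0 1 \ C

/-- The Schwarzian derivative `f'''/f' - (3/2) (f''/f')²` of `f` at `x`, relative to the set `S`
(so that it is one-sided at the end points of `[0,1]`). -/
def schwarzian (f : ℝ → ℝ) (S : Set ℝ) (x : ℝ) : ℝ :=
  iteratedDerivWithin 3 f S x / derivWithin f S x
    - 3 / 2 * (iteratedDerivWithin 2 f S x / derivWithin f S x) ^ 2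

/-- `f : [0,1] ∖ C → [0,1]` is a `C³` local diffeomorphism with negative Schwarzian derivative,
where the exceptional set `C ⊆ (0,1)` is finite. The values of `f` on `C` and outside `[0,1]`
play no role. -/
structure IsPiecewiseNegSchwarzian (f : ℝ → ℝ) (C : Set ℝ) : Prop where
  finite_exceptional : C.Finite
  exceptional_subset : C ⊆ Ioo 0 1
  mapsTo : MapsTo f (dom C) (Icc 0 1)
  contDiffOn : ContDiffOn ℝ 3 f (dom C)
  deriv_ne_zero : ∀ x ∈ dom C, derivWithin f (dom C) x ≠ 0
  schwarzian_neg : ∀ x ∈ dom C, schwarzian f (dom C) x < 0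

/-- The omega-limit set `ω_f(x)`: all limits of `f^{n_j}(x)` with `n_j → ∞`. It is empty if the
forward orbit of `x` meets the exceptional set, where the orbit stops. -/
def omegaSet (f : ℝ → ℝ) (C : Set ℝ) (x : ℝ) : Set ℝ :=
  {y | (∀ n : ℕ, f^[n] x ∉ C) ∧
    ∃ n : ℕ → ℕ, Tendsto n atTop atTop ∧ Tendsto (fun j => f^[n j] x) atTop (𝓝 y)}

/-- The basin of attraction `β_f(A) = {x ∈ [0,1] ; ω_f(x) ⊆ A}`. -/
def basin (f : ℝ → ℝ) (C A : Set ℝ) : Set ℝ :=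
  {x | x ∈ Icc (0 : ℝ) 1 ∧ omegaSet f C x ⊆ A}

/-- A (metrical) attractor: a compact set whose basin has positive Lebesgue measure and that has
no strictly smaller closed subset with the same basin up to measure zero. -/
def IsMetricalAttractor (f : ℝ → ℝ) (C A : Set ℝ) : Prop :=
  A ⊆ Icc 0 1 ∧ IsCompact A ∧ 0 < volume (basin f C A) ∧
    ¬ ∃ A' : Set ℝ, IsClosed A' ∧ A' ⊂ A ∧ basin f C A' =ᵐ[volume] basin f C A

/-- The action of `f` on lateral points `p ± i`:
`f(p - i) = lim_{x↑p} f(x) - i lim_{x↑p} f'(x)/|f'(x)|` and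
`f(p + i) = lim_{x↓p} f(x) + i lim_{x↓p} f'(x)/|f'(x)|`. -/
def lateralMap (f : ℝ → ℝ) (α : ℂ) : ℂ :=
  if α.im < 0 then
    ⟨limUnder (𝓝[<] α.re) f, -limUnder (𝓝[<] α.re) (fun x => deriv f x / |deriv f x|)⟩
  else
    ⟨limUnder (𝓝[>] α.re) f, limUnder (𝓝[>] α.re) (fun x => deriv f x / |deriv f x|)⟩

/-- The lateral points of `[0,1]`: `p - i` for `0 < p ≤ 1` and `p + i` for `0 ≤ p < 1`. -/
def lateralPoints : Set ℂ :=
  {α | (α.im = -1 ∧ α.re ∈ Ioc (0 : ℝ) 1) ∨ (α.im = 1 ∧ α.re ∈ Ico (0 : ℝ) 1)}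

/-- The lateral exceptional set `{c - i ; c ∈ C} ∪ {c + i ; c ∈ C}`. -/
def lateralExceptionalSet (C : Set ℝ) : Set ℂ :=
  {α | ∃ c ∈ C, α = (c : ℂ) - Complex.I ∨ α = (c : ℂ) + Complex.I}

/-- The real parts of the forward orbits of the lateral exceptional values, that is,
`{Re (f^n(α)) ; α = c ± i, c ∈ C, n ≥ 1}`. -/
def exceptionalValueOrbits (f : ℝ → ℝ) (C : Set ℝ) : Set ℝ :=
  {y | ∃ α ∈ lateralExceptionalSet C, ∃ n : ℕ, 1 ≤ n ∧ y = ((lateralMap f)^[n] α).re}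

/-- A periodic-like orbit: the set of real parts of the forward orbit of a lateral point
`α = p ± i` with `f^n(α) = α` for some `n ≥ 1`. -/
def IsPeriodicLikeOrbit (f : ℝ → ℝ) (A : Set ℝ) : Prop :=
  ∃ α ∈ lateralPoints, (∃ n : ℕ, 1 ≤ n ∧ (lateralMap f)^[n] α = α) ∧
    A = {y | ∃ j : ℕ, y = ((lateralMap f)^[j] α).re}

/-- A periodic-like attractor: an attractor that is a periodic-like orbit. -/
def IsPeriodicLikeAttractor (f : ℝ → ℝ) (C A : Set ℝ) : Prop :=
  IsPeriodicLikeOrbit f A ∧ IsMetricalAttractor f C A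

/-- The union of the basins of all periodic-like attractors. -/
def periodicLikeBasin (f : ℝ → ℝ) (C : Set ℝ) : Set ℝ :=
  {x | ∃ A : Set ℝ, IsPeriodicLikeAttractor f C A ∧ x ∈ basin f C A}

end IntervalDynamics

end

/-! Negative Schwarzian derivative makes every iterate of f strictly expand cross-ratios on
intervals where it is defined, which gives Koebe-type distortion control without any bound on
derivatives. Moreover, let V be a maximal interval on which f^n is defined, with both ends inside
(0,1). The one-sided limits of f^n at the ends of V lie on orbits of lateral exceptional values,
hence outside I, so f^n(V) contains I as soon as it meets I (`exists_Ioo_subset_image`). Returns to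
I are therefore full branches.

Let `stableDom` be the set of points whose orbit stays in (0,1) ∖ C, and consider points whose orbit
accumulates in I. For an interior point of `stableDom` there are two cases. If no two iterates lie
in a common component of `stableDom`, a small interval around the point wanders: its images are
disjoint, so they shrink, which contradicts the distortion estimate over I (`not_wandering`).
Otherwise some component is mapped into itself by some f^k, and monotonicity makes the point
preperiodic or attracted to a periodic-like attractor. Preperiodic points form a null set, because a
cross-ratio expanding map has at most three fixed points.

The other points of I form `recurrentSet`. A measurable part of it that is invariant under returns
and has positive measure has a density point; full branches carry the density at small scales to
compact subintervals of I, so the part has full measure in I (`volume_diff_eq_zero_of_invariant`).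
If `recurrentSet` is null, the first alternative holds. If not, it has full measure, and the same
zero-one law shows that the orbits missing a given rational subinterval are negligible
(`ae_visits`), so almost every orbit accumulates on all of I. -/

namespace IntervalDynamics

/-! ### From negative Schwarzian derivative to expansion of cross-ratios. -/

/-- The inverse square root of the derivative of a map with negative Schwarzian derivative is
strictly convex. -/
theorem strictConvexOn_rpow_deriv {d e g : ℝ → ℝ} {J : Set ℝ} (hJ : J.OrdConnected)
    (hd : ∀ p ∈ J, HasDerivAt d (e p) p) (he : ∀ p ∈ J, HasDerivAt e (g p) p)
    (hpos : ∀ p ∈ J, 0 < d p)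
    (hS : ∀ p ∈ J, g p / d p - 3 / 2 * (e p / d p) ^ 2 < 0) :
    StrictConvexOn ℝ J (fun p => d p ^ (-(1 / 2) : ℝ)) := by
  have h1 : ∀ p ∈ J, HasDerivAt (fun p => d p ^ (-(1 / 2) : ℝ))
      (e p * (-(1 / 2)) * d p ^ (-(1 / 2) - 1 : ℝ)) p := fun p hp =>
    (hd p hp).rpow_const (Or.inl (hpos p hp).ne')
  have h2 : ∀ p ∈ J, HasDerivAt (fun p => e p * (-(1 / 2)) * d p ^ (-(1 / 2) - 1 : ℝ))
      (g p * (-(1 / 2)) * d p ^ (-(1 / 2) - 1 : ℝ) +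
        e p * (-(1 / 2)) * (e p * (-(1 / 2) - 1) * d p ^ (-(1 / 2) - 1 - 1 : ℝ))) p :=
    fun p hp => ((he p hp).mul_const _).mul ((hd p hp).rpow_const (Or.inl (hpos p hp).ne'))
  refine strictConvexOn_of_deriv2_pos hJ.convex
    (fun p hp => (h1 p hp).continuousAt.continuousWithinAt) fun p hp => ?_
  have hpJ := interior_subset hp
  have hev : deriv (fun p => d p ^ (-(1 / 2) : ℝ)) =ᶠ[𝓝 p]
      fun p => e p * (-(1 / 2)) * d p ^ (-(1 / 2) - 1 : ℝ) := by
    filter_upwards [mem_interior_iff_mem_nhds.1 hp] with q hq using (h1 q hq).deriv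
  have : deriv^[2] (fun p => d p ^ (-(1 / 2) : ℝ)) p =
      deriv (deriv (fun p => d p ^ (-(1 / 2) : ℝ))) p := rfl
  rw [this, hev.deriv_eq, (h2 p hpJ).deriv]
  have hd0 := hpos p hpJ
  rw [Real.rpow_sub_one hd0.ne' (-(1 / 2) - 1), Real.rpow_sub_one hd0.ne' (-(1 / 2))]
  have hr : 0 < d p ^ (-(1 / 2) : ℝ) := Real.rpow_pos_of_pos hd0 _
  have := hS p hpJ
  -- The classical identity `(d^(-1/2))'' = -(1/2) * S * d^(-1/2)`, with `S` the Schwarzian.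
  have key : g p * (-(1 / 2)) * (d p ^ (-(1 / 2) : ℝ) / d p) +
      e p * (-(1 / 2)) * (e p * (-(1 / 2) - 1) * (d p ^ (-(1 / 2) : ℝ) / d p / d p)) =
      d p ^ (-(1 / 2) : ℝ) * (-(1 / 2) * (g p / d p - 3 / 2 * (e p / d p) ^ 2)) := by
    field_simp
    ring
  rw [key]
  exact mul_pos hr (by linarith)

/-- If `(f')^{-1/2}` is strictly convex then `f'(s) f'(t)` is less than the square of the slope. -/
theorem deriv_mul_deriv_lt {f d : ℝ → ℝ} {J : Set ℝ} (hJ : J.OrdConnected)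
    (hf : ∀ p ∈ J, HasDerivAt f (d p) p) (hpos : ∀ p ∈ J, 0 < d p)
    (hc : StrictConvexOn ℝ J (fun p => d p ^ (-(1 / 2) : ℝ)))
    {s t : ℝ} (hs : s ∈ J) (ht : t ∈ J) (hst : s < t) :
    d s * d t * (t - s) ^ 2 < (f t - f s) ^ 2 := by
  set φ : ℝ → ℝ := fun p => d p ^ (-(1 / 2) : ℝ) with hφ
  have φpos : ∀ p ∈ J, 0 < φ p := fun p hp => Real.rpow_pos_of_pos (hpos p hp) _
  have φsq : ∀ p ∈ J, d p * φ p ^ 2 = 1 := fun p hp => by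
    have h0 := hpos p hp
    rw [hφ]
    simp only
    rw [← Real.rpow_natCast, ← Real.rpow_mul h0.le]
    norm_num
    rw [Real.rpow_neg_one]
    exact mul_inv_cancel₀ h0.ne'
  have hsub : Icc s t ⊆ J := hJ.out hs ht
  have hts : 0 < t - s := sub_pos.2 hst
  set m : ℝ := (φ t - φ s) / (t - s) with hm
  set l : ℝ → ℝ := fun τ => φ s + (τ - s) * m with hl
  have hlt : l t = φ t := by simp only [hl, hm]; field_simp; ring
  have hlconv : ∀ τ, l τ = (t - τ) / (t - s) * φ s + (τ - s) / (t - s) * φ t := by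
    intro τ; simp only [hl, hm]; field_simp; ring
  have hlpos : ∀ τ ∈ Icc s t, 0 < l τ := by
    intro τ hτ
    have h1 : l τ * (t - s) = (t - τ) * φ s + (τ - s) * φ t := by
      rw [hlconv]; field_simp
    have h2 := φpos s hs
    have h3 := φpos t ht
    have : 0 < l τ * (t - s) := by
      rw [h1]
      rcases eq_or_lt_of_le hτ.1 with h | h
      · subst h; nlinarith
      · have := mul_pos (sub_pos.2 h) h3
        have := mul_nonneg (sub_nonneg.2 hτ.2) h2.le
        linarith
    exact (mul_pos_iff_of_pos_right hts).1 this
  have hφl : ∀ τ ∈ Ioo s t, φ τ < l τ := by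
    intro τ hτ
    have := hc.2 hs ht hst.ne
      (show 0 < (t - τ) / (t - s) from div_pos (sub_pos.2 hτ.2) hts)
      (show 0 < (τ - s) / (t - s) from div_pos (sub_pos.2 hτ.1) hts) (by field_simp; ring)
    simp only [smul_eq_mul] at this
    rw [hlconv]
    have e : τ = (t - τ) / (t - s) * s + (τ - s) / (t - s) * t := by
      field_simp
      ring
    rwa [← e] at this
  -- The subtracted term is the primitive of `1 / l ^ 2` vanishing at `s`, where `l` is the chord of
  -- `φ`. Convexity puts `φ` below `l`, so `d = 1 / φ ^ 2` exceeds `1 / l ^ 2` inside and `D`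
  -- increases.
  set D : ℝ → ℝ := fun τ => f τ - (τ - s) / (φ s * l τ) with hD
  have hDd : ∀ τ ∈ Icc s t, HasDerivAt D (d τ - 1 / l τ ^ 2) τ := by
    intro τ hτ
    have hlne := (hlpos τ hτ).ne'
    have hφs := (φpos s hs).ne'
    have hl' : HasDerivAt l m τ := by
      have := (((hasDerivAt_id τ).sub_const s).mul_const m).const_add (φ s)
      rwa [one_mul] at this
    have := (hf τ (hsub hτ)).sub
      (((hasDerivAt_id τ).sub_const s).div (hl'.const_mul (φ s)) (mul_ne_zero hφs hlne))
    refine HasDerivAt.congr_deriv this ?_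
    simp only [id]
    have : φ s = l τ - (τ - s) * m := by simp [hl]
    field_simp
    rw [this]
    ring
  have hmono : StrictMonoOn D (Icc s t) := by
    refine strictMonoOn_of_deriv_pos (convex_Icc s t)
      (fun τ hτ => (hDd τ hτ).continuousAt.continuousWithinAt) fun τ hτ => ?_
    rw [interior_Icc] at hτ
    have hτ' := Ioo_subset_Icc_self hτ
    rw [(hDd τ hτ').deriv]
    have h1 := φpos τ (hsub hτ')
    have h2 := hφl τ hτ
    have h3 := φsq τ (hsub hτ')
    have h4 : d τ = 1 / φ τ ^ 2 := by field_simp; exact h3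
    rw [h4, sub_pos]
    exact one_div_lt_one_div_of_lt (by positivity) (by gcongr)
  have h := hmono (left_mem_Icc.2 hst.le) (right_mem_Icc.2 hst.le) hst
  simp only [hD, hlt, sub_self, zero_div, sub_zero] at h
  have hs2 := φpos s hs
  have ht2 := φpos t ht
  have h5 : (t - s) / (φ s * φ t) < f t - f s := by linarith
  have h6 : ((t - s) / (φ s * φ t)) ^ 2 < (f t - f s) ^ 2 := by gcongr
  convert h6 using 1
  have h7 := φsq s hs
  have h8 := φsq t ht
  have h9 : d s = 1 / φ s ^ 2 := by field_simp; exact h7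
  have h10 : d t = 1 / φ t ^ 2 := by field_simp; exact h8
  rw [h9, h10]
  field_simp

/-- An increasing map with negative Schwarzian derivative strictly expands cross-ratios. -/
theorem crossRatio_lt_of_deriv {f d : ℝ → ℝ} {J : Set ℝ} (hJ : J.OrdConnected)
    (hf : ∀ p ∈ J, HasDerivAt f (d p) p) (hpos : ∀ p ∈ J, 0 < d p)
    (hc : StrictConvexOn ℝ J (fun p => d p ^ (-(1 / 2) : ℝ)))
    {x y z w : ℝ} (hx : x ∈ J) (hw : w ∈ J) (hxy : x < y) (hyz : y < z) (hzw : z < w) :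
    (w - x) * (z - y) * ((f w - f y) * (f z - f x)) <
      (f w - f x) * (f z - f y) * ((w - y) * (z - x)) := by
  have hsub : Icc x w ⊆ J := hJ.out hx hw
  have hfm : StrictMonoOn f (Icc x w) := by
    refine strictMonoOn_of_deriv_pos (convex_Icc x w)
      (fun τ hτ => (hf τ (hsub hτ)).continuousAt.continuousWithinAt) fun τ hτ => ?_
    have hτ := hsub (interior_subset hτ)
    rw [(hf τ hτ).deriv]; exact hpos τ hτ
  -- Integration over `s ∈ [x, y]`, with `t` fixed, of `d s * d t / (f t - f s) ^ 2 < 1 / (t - s) ^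
  -- 2`.
  have hk : ∀ t ∈ Icc z w,
      1 / (t - x) - 1 / (t - y) < d t * (1 / (f t - f x) - 1 / (f t - f y)) := by
    intro t ht
    have htJ : t ∈ Icc x w := ⟨by linarith [ht.1], ht.2⟩
    have hlt : ∀ s ∈ Icc x y, 0 < t - s := fun s hs => by linarith [hs.2, ht.1]
    have hmem : ∀ s ∈ Icc x y, s ∈ Icc x w := fun s hs => ⟨hs.1, by linarith [hs.2]⟩
    have hflt : ∀ s ∈ Icc x y, 0 < f t - f s := fun s hs =>
      sub_pos.2 (hfm (hmem s hs) htJ (by linarith [hlt s hs]))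
    have hder : ∀ s ∈ Icc x y, HasDerivAt (fun s => d t / (f t - f s) - 1 / (t - s))
        (d t * d s / (f t - f s) ^ 2 - 1 / (t - s) ^ 2) s := by
      intro s hs
      have h1 := (hflt s hs).ne'
      have h2 := (hlt s hs).ne'
      have := ((hasDerivAt_const s (d t)).div ((hf s (hsub (hmem s hs))).const_sub (f t)) h1).sub
        ((hasDerivAt_const s (1 : ℝ)).div ((hasDerivAt_id s).const_sub t) h2)
      exact HasDerivAt.congr_deriv this (by simp)
    have hanti : StrictAntiOn (fun s => d t / (f t - f s) - 1 / (t - s)) (Icc x y) := by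
      refine strictAntiOn_of_deriv_neg (convex_Icc x y)
        (fun τ hτ => (hder τ hτ).continuousAt.continuousWithinAt) fun s hs => ?_
      have hs := interior_subset hs
      rw [(hder s hs).deriv]
      have h1 := hflt s hs
      have h2 := hlt s hs
      have := deriv_mul_deriv_lt hJ hf hpos hc (hsub (hmem s hs)) (hsub htJ) (by linarith)
      rw [sub_neg, div_lt_div_iff₀ (by positivity) (by positivity)]
      linarith
    have := hanti (left_mem_Icc.2 hxy.le) (right_mem_Icc.2 hxy.le) hxy
    simp only at this
    have e1 : d t * (1 / (f t - f x) - 1 / (f t - f y)) =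
      d t / (f t - f x) - d t / (f t - f y) := by ring
    rw [e1]
    linarith
  have hp1 : ∀ t ∈ Icc z w, 0 < t - x := fun t ht => by linarith [ht.1]
  have hp2 : ∀ t ∈ Icc z w, 0 < t - y := fun t ht => by linarith [ht.1]
  have hmem : ∀ t ∈ Icc z w, t ∈ Icc x w := fun s hs => ⟨by linarith [hs.1], hs.2⟩
  have hp3 : ∀ t ∈ Icc z w, 0 < f t - f x := fun t ht =>
    sub_pos.2 (hfm ⟨le_rfl, by linarith⟩ (hmem t ht) (by linarith [hp1 t ht]))
  have hp4 : ∀ t ∈ Icc z w, 0 < f t - f y := fun t ht =>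
    sub_pos.2 (hfm ⟨hxy.le, by linarith⟩ (hmem t ht) (by linarith [hp2 t ht]))
  -- Second integration, over `t ∈ [z, w]`; it produces the logarithm of the ratio of the two
  -- cross-ratios.
  have hder : ∀ t ∈ Icc z w, HasDerivAt
      (fun t => Real.log (f t - f x) - Real.log (f t - f y)
        - (Real.log (t - x) - Real.log (t - y)))
      (d t / (f t - f x) - d t / (f t - f y) - (1 / (t - x) - 1 / (t - y))) t := by
    intro t ht
    have hft := hf t (hsub (hmem t ht))
    exact (((hft.sub_const _).log (hp3 t ht).ne').sub ((hft.sub_const _).log (hp4 t ht).ne')).sub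
      ((((hasDerivAt_id t).sub_const x).log (hp1 t ht).ne').sub
        (((hasDerivAt_id t).sub_const y).log (hp2 t ht).ne'))
  have hmono := strictMonoOn_of_deriv_pos (convex_Icc z w)
    (fun τ hτ => (hder τ hτ).continuousAt.continuousWithinAt) (fun t ht => by
      have ht := interior_subset ht
      rw [(hder t ht).deriv]
      have := hk t ht
      have e1 : d t * (1 / (f t - f x) - 1 / (f t - f y)) =
        d t / (f t - f x) - d t / (f t - f y) := by ring
      linarith)
  have hz : z ∈ Icc z w := left_mem_Icc.2 hzw.le
  have hw' : w ∈ Icc z w := right_mem_Icc.2 hzw.le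
  have h := hmono hz hw' hzw
  simp only at h
  have a1 := hp1 z hz; have a2 := hp2 z hz; have a3 := hp3 z hz; have a4 := hp4 z hz
  have b1 := hp1 w hw'; have b2 := hp2 w hw'; have b3 := hp3 w hw'; have b4 := hp4 w hw'
  rw [← Real.log_lt_log_iff (by positivity) (by positivity)]
  rw [Real.log_mul (by positivity) (by positivity), Real.log_mul b1.ne' a2.ne',
    Real.log_mul b4.ne' a3.ne', Real.log_mul (by positivity) (by positivity),
    Real.log_mul b3.ne' a4.ne', Real.log_mul b2.ne' a1.ne']
  linarith

/-! ### Cross-ratio expanding maps: composition and fixed points. -/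

/-- The open set `(0,1) ∖ C`. -/
def openDom (C : Set ℝ) : Set ℝ := Ioo 0 1 \ C

/-- A strictly monotone continuous map on `J` that strictly expands cross-ratios. -/
structure ExpandsCrossRatio (g : ℝ → ℝ) (J : Set ℝ) : Prop where
  mono_or_anti : StrictMonoOn g J ∨ StrictAntiOn g J
  continuousOn : ContinuousOn g J
  crossRatio_lt : ∀ x ∈ J, ∀ y ∈ J, ∀ z ∈ J, ∀ w ∈ J, x < y → y < z → z < w →
    (w - x) * (z - y) * ((g w - g y) * (g z - g x)) <
      (g w - g x) * (g z - g y) * ((w - y) * (z - x))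

namespace ExpandsCrossRatio

variable {g h : ℝ → ℝ} {J : Set ℝ}

theorem injOn (hg : ExpandsCrossRatio g J) : InjOn g J :=
  hg.mono_or_anti.elim StrictMonoOn.injOn StrictAntiOn.injOn

theorem ordConnected_image (hg : ExpandsCrossRatio g J) (hJ : J.OrdConnected) :
    (g '' J).OrdConnected :=
  (hJ.isPreconnected.image g hg.continuousOn).ordConnected

theorem comp (hh : ExpandsCrossRatio h (g '' J)) (hg : ExpandsCrossRatio g J) :
    ExpandsCrossRatio (h ∘ g) J where
  mono_or_anti := by
    have hm := mapsTo_image g J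
    rcases hg.mono_or_anti with h1 | h1 <;> rcases hh.mono_or_anti with h2 | h2
    · exact Or.inl fun x hx y hy hxy => h2 (hm hx) (hm hy) (h1 hx hy hxy)
    · exact Or.inr fun x hx y hy hxy => h2 (hm hx) (hm hy) (h1 hx hy hxy)
    · exact Or.inr fun x hx y hy hxy => h2 (hm hy) (hm hx) (h1 hx hy hxy)
    · exact Or.inl fun x hx y hy hxy => h2 (hm hy) (hm hx) (h1 hx hy hxy)
  continuousOn := hh.continuousOn.comp hg.continuousOn (mapsTo_image g J)
  crossRatio_lt := by
    intro x hx y hy z hz w hw hxy hyz hzw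
    have hm := mapsTo_image g J
    have h1 := hg.crossRatio_lt x hx y hy z hz w hw hxy hyz hzw
    simp only [Function.comp]
    have e1 : 0 < (w - y) * (z - x) := mul_pos (by linarith) (by linarith)
    rcases hg.mono_or_anti with hmo | hmo
    · have a := hmo hx hy hxy
      have b := hmo hy hz hyz
      have c := hmo hz hw hzw
      have h2 := hh.crossRatio_lt _ (hm hx) _ (hm hy) _ (hm hz) _ (hm hw) a b c
      have e3 : 0 < (g w - g y) * (g z - g x) := mul_pos (by linarith) (by linarith)
      have e4 : 0 < (g w - g x) * (g z - g y) := mul_pos (by linarith) (by linarith)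
      have e5 : 0 < (h (g w) - h (g y)) * (h (g z) - h (g x)) := by
        rcases hh.mono_or_anti with hk | hk
        · exact mul_pos (sub_pos.2 (hk (hm hy) (hm hw) (b.trans c)))
            (sub_pos.2 (hk (hm hx) (hm hz) (a.trans b)))
        · exact mul_pos_of_neg_of_neg (sub_neg.2 (hk (hm hy) (hm hw) (b.trans c)))
            (sub_neg.2 (hk (hm hx) (hm hz) (a.trans b)))
      rw [← mul_lt_mul_iff_of_pos_left e3]
      calc _ = (w - x) * (z - y) * ((g w - g y) * (g z - g x)) *
              ((h (g w) - h (g y)) * (h (g z) - h (g x))) := by ring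
        _ < (g w - g x) * (g z - g y) * ((w - y) * (z - x)) *
              ((h (g w) - h (g y)) * (h (g z) - h (g x))) := by gcongr
        _ = (g w - g x) * (g z - g y) * ((h (g w) - h (g y)) * (h (g z) - h (g x))) *
              ((w - y) * (z - x)) := by ring
        _ < (h (g w) - h (g x)) * (h (g z) - h (g y)) * ((g w - g y) * (g z - g x)) *
              ((w - y) * (z - x)) := by gcongr
        _ = _ := by ring
    -- Here `g` reverses the four points; both sides of the cross-ratio inequality are unchanged
    -- under `x ↔ w`, `y ↔ z`.
    · have a := hmo hx hy hxy
      have b := hmo hy hz hyz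
      have c := hmo hz hw hzw
      have h2 := hh.crossRatio_lt _ (hm hw) _ (hm hz) _ (hm hy) _ (hm hx) c b a
      have e3 : 0 < (g w - g y) * (g z - g x) :=
        mul_pos_of_neg_of_neg (by linarith) (by linarith)
      have e4 : 0 < (g w - g x) * (g z - g y) :=
        mul_pos_of_neg_of_neg (by linarith) (by linarith)
      have e5 : 0 < (h (g w) - h (g y)) * (h (g z) - h (g x)) := by
        rcases hh.mono_or_anti with hk | hk
        · exact mul_pos_of_neg_of_neg (sub_neg.2 (hk (hm hw) (hm hy) (c.trans b)))
            (sub_neg.2 (hk (hm hz) (hm hx) (b.trans a)))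
        · exact mul_pos (sub_pos.2 (hk (hm hw) (hm hy) (c.trans b)))
            (sub_pos.2 (hk (hm hz) (hm hx) (b.trans a)))
      rw [← mul_lt_mul_iff_of_pos_left e3]
      calc _ = (w - x) * (z - y) * ((g w - g y) * (g z - g x)) *
              ((h (g w) - h (g y)) * (h (g z) - h (g x))) := by ring
        _ < (g w - g x) * (g z - g y) * ((w - y) * (z - x)) *
              ((h (g w) - h (g y)) * (h (g z) - h (g x))) := by gcongr
        _ = (g x - g w) * (g y - g z) * ((h (g x) - h (g z)) * (h (g y) - h (g w))) *
              ((w - y) * (z - x)) := by ring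
        _ < (h (g x) - h (g w)) * (h (g y) - h (g z)) * ((g x - g z) * (g y - g w)) *
              ((w - y) * (z - x)) := by gcongr
        _ = _ := by ring

/-- A map that strictly expands cross-ratios has at most three fixed points. -/
theorem finite_fixedPoints (hg : ExpandsCrossRatio g J) : {x ∈ J | g x = x}.Finite := by
  by_contra hinf
  obtain ⟨t, ht, hc⟩ := Set.Infinite.exists_subset_card_eq hinf 4
  have hlt : ∀ i j : Fin 4, i < j → t.orderEmbOfFin hc i < t.orderEmbOfFin hc j :=
    fun i j hij => (t.orderEmbOfFin hc).strictMono hij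
  have hm : ∀ i, t.orderEmbOfFin hc i ∈ J ∧ g (t.orderEmbOfFin hc i) = t.orderEmbOfFin hc i :=
    fun i => ht (t.orderEmbOfFin_mem hc i)
  have := hg.crossRatio_lt _ (hm 0).1 _ (hm 1).1 _ (hm 2).1 _ (hm 3).1
    (hlt 0 1 (by decide)) (hlt 1 2 (by decide)) (hlt 2 3 (by decide))
  -- At four fixed points the two sides of the strict inequality coincide.
  rw [(hm 0).2, (hm 1).2, (hm 2).2, (hm 3).2] at this
  linarith

end ExpandsCrossRatio

/-! ### The map on (0,1) ∖ C, where all derivatives are two-sided. -/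

variable {f : ℝ → ℝ} {C : Set ℝ}

namespace IsPiecewiseNegSchwarzian

theorem isOpen_openDom (hf : IsPiecewiseNegSchwarzian f C) : IsOpen (openDom C) :=
  isOpen_Ioo.sdiff hf.finite_exceptional.isClosed

theorem contDiffOn_openDom (hf : IsPiecewiseNegSchwarzian f C) :
    ContDiffOn ℝ 3 f (openDom C) :=
  hf.contDiffOn.mono fun _ hx => ⟨Ioo_subset_Icc_self hx.1, hx.2⟩

theorem dom_mem_nhds (hf : IsPiecewiseNegSchwarzian f C) {p : ℝ} (hp : p ∈ openDom C) :
    dom C ∈ 𝓝 p :=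
  mem_of_superset (hf.isOpen_openDom.mem_nhds hp) fun _ hx => ⟨Ioo_subset_Icc_self hx.1, hx.2⟩

theorem hasDerivAt_iteratedDeriv (hf : IsPiecewiseNegSchwarzian f C) {p : ℝ}
    (hp : p ∈ openDom C) {n : ℕ} (hn : n < 3) :
    HasDerivAt (iteratedDeriv n f) (iteratedDeriv (n + 1) f p) p := by
  have hc : ContDiffWithinAt ℝ 3 f univ p :=
    (hf.contDiffOn_openDom.contDiffAt (hf.isOpen_openDom.mem_nhds hp)).contDiffWithinAt
  have := hc.differentiableWithinAt_iteratedDerivWithin (m := n) (by exact_mod_cast hn)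
    (by simp)
  rw [iteratedDerivWithin_univ, differentiableWithinAt_univ] at this
  rw [iteratedDeriv_succ]
  exact this.hasDerivAt

theorem hasDerivAt (hf : IsPiecewiseNegSchwarzian f C) {p : ℝ} (hp : p ∈ openDom C) :
    HasDerivAt f (deriv f p) p := by
  simpa [iteratedDeriv_one] using hf.hasDerivAt_iteratedDeriv hp (n := 0) (by norm_num)

theorem continuousOn_openDom (hf : IsPiecewiseNegSchwarzian f C) :
    ContinuousOn f (openDom C) :=
  fun _ hp => (hf.hasDerivAt hp).continuousAt.continuousWithinAt

theorem iteratedDerivWithin_eq (hf : IsPiecewiseNegSchwarzian f C) {p : ℝ}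
    (hp : p ∈ openDom C) (n : ℕ) : iteratedDerivWithin n f (dom C) p = iteratedDeriv n f p := by
  rw [← iteratedDerivWithin_univ, iteratedDerivWithin, iteratedDerivWithin,
    iteratedFDerivWithin_congr_set (eventuallyEq_univ.2 (hf.dom_mem_nhds hp))]

theorem derivWithin_eq (hf : IsPiecewiseNegSchwarzian f C) {p : ℝ}
    (hp : p ∈ openDom C) : derivWithin f (dom C) p = deriv f p :=
  derivWithin_of_mem_nhds (hf.dom_mem_nhds hp)

theorem deriv_ne_zero' (hf : IsPiecewiseNegSchwarzian f C) {p : ℝ}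
    (hp : p ∈ openDom C) : deriv f p ≠ 0 := by
  rw [← hf.derivWithin_eq hp]
  exact hf.deriv_ne_zero p (mem_of_mem_nhds (hf.dom_mem_nhds hp))

theorem schwarzian_neg' (hf : IsPiecewiseNegSchwarzian f C) {p : ℝ} (hp : p ∈ openDom C) :
    iteratedDeriv 3 f p / deriv f p - 3 / 2 * (iteratedDeriv 2 f p / deriv f p) ^ 2 < 0 := by
  have := hf.schwarzian_neg p (mem_of_mem_nhds (hf.dom_mem_nhds hp))
  rwa [schwarzian, hf.iteratedDerivWithin_eq hp, hf.iteratedDerivWithin_eq hp,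
    hf.derivWithin_eq hp] at this

/-- On an interval where `f` is defined, its derivative has constant sign. -/
theorem deriv_pos_or_neg (hf : IsPiecewiseNegSchwarzian f C) {J : Set ℝ} (hJ : J.OrdConnected)
    (hJC : J ⊆ openDom C) : (∀ p ∈ J, 0 < deriv f p) ∨ (∀ p ∈ J, deriv f p < 0) := by
  have hc : ContinuousOn (deriv f) J := fun p hp => by
    have := (hf.hasDerivAt_iteratedDeriv (hJC hp) (n := 1) (by norm_num)).continuousAt
    rw [iteratedDeriv_one] at this
    exact this.continuousWithinAt
  by_contra! hcon
  obtain ⟨⟨p, hp, hp'⟩, q, hq, hq'⟩ := hcon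
  obtain ⟨r, hr, hr0⟩ := hJ.isPreconnected.intermediate_value hp hq hc ⟨hp', hq'⟩
  exact hf.deriv_ne_zero' (hJC hr) hr0

theorem strictMonoOn_of_deriv_pos (hf : IsPiecewiseNegSchwarzian f C) {J : Set ℝ}
    (hJ : J.OrdConnected) (hJC : J ⊆ openDom C) (h : ∀ p ∈ J, 0 < deriv f p) :
    StrictMonoOn f J :=
  _root_.strictMonoOn_of_deriv_pos hJ.convex (hf.continuousOn_openDom.mono hJC)
    fun p hp => h p (interior_subset hp)

theorem strictAntiOn_of_deriv_neg (hf : IsPiecewiseNegSchwarzian f C) {J : Set ℝ}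
    (hJ : J.OrdConnected) (hJC : J ⊆ openDom C) (h : ∀ p ∈ J, deriv f p < 0) :
    StrictAntiOn f J :=
  _root_.strictAntiOn_of_deriv_neg hJ.convex (hf.continuousOn_openDom.mono hJC)
    fun p hp => h p (interior_subset hp)

theorem expandsCrossRatio (hf : IsPiecewiseNegSchwarzian f C) {J : Set ℝ}
    (hJ : J.OrdConnected) (hJC : J ⊆ openDom C) : ExpandsCrossRatio f J := by
  have h0 : ∀ p ∈ J, HasDerivAt f (deriv f p) p := fun p hp => hf.hasDerivAt (hJC hp)
  have h1 : ∀ p ∈ J, HasDerivAt (deriv f) (iteratedDeriv 2 f p) p := fun p hp => by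
    have := hf.hasDerivAt_iteratedDeriv (hJC hp) (n := 1) (by norm_num)
    rwa [iteratedDeriv_one] at this
  have h2 : ∀ p ∈ J, HasDerivAt (iteratedDeriv 2 f) (iteratedDeriv 3 f p) p := fun p hp =>
    hf.hasDerivAt_iteratedDeriv (hJC hp) (n := 2) (by norm_num)
  have hS := fun p (hp : p ∈ J) => hf.schwarzian_neg' (hJC hp)
  rcases hf.deriv_pos_or_neg hJ hJC with hpos | hneg
  · refine ⟨Or.inl (hf.strictMonoOn_of_deriv_pos hJ hJC hpos),
      hf.continuousOn_openDom.mono hJC, ?_⟩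
    intro x hx y _ z _ w hw hxy hyz hzw
    exact crossRatio_lt_of_deriv hJ h0 hpos (strictConvexOn_rpow_deriv hJ h1 h2 hpos hS)
      hx hw hxy hyz hzw
  · refine ⟨Or.inr (hf.strictAntiOn_of_deriv_neg hJ hJC hneg),
      hf.continuousOn_openDom.mono hJC, ?_⟩
    intro x hx y _ z _ w hw hxy hyz hzw
    -- The Schwarzian and the cross-ratio inequality are both invariant under `f ↦ -f`.
    have hpos : ∀ p ∈ J, 0 < - deriv f p := fun p hp => neg_pos.2 (hneg p hp)
    have := crossRatio_lt_of_deriv hJ (f := fun p => - f p) (fun p hp => (h0 p hp).neg) hpos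
      (strictConvexOn_rpow_deriv hJ (e := fun p => - iteratedDeriv 2 f p)
        (g := fun p => - iteratedDeriv 3 f p) (fun p hp => (h1 p hp).neg)
        (fun p hp => (h2 p hp).neg) hpos
        (fun p hp => by simpa only [neg_div_neg_eq] using hS p hp)) hx hw hxy hyz hzw
    linarith

/-- Interior points are mapped to interior points. -/
theorem mapsTo_Ioo (hf : IsPiecewiseNegSchwarzian f C) : MapsTo f (openDom C) (Ioo 0 1) := by
  intro p hp
  obtain ⟨l, r, hlr, hsub⟩ := mem_nhds_iff_exists_Ioo_subset.1 (hf.isOpen_openDom.mem_nhds hp)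
  obtain ⟨l', hl'⟩ := exists_between hlr.1
  obtain ⟨r', hr'⟩ := exists_between hlr.2
  have hg := hf.expandsCrossRatio ordConnected_Ioo hsub
  have hIcc : ∀ q ∈ Ioo l r, f q ∈ Icc (0 : ℝ) 1 := fun q hq =>
    hf.mapsTo ⟨Ioo_subset_Icc_self (hsub hq).1, (hsub hq).2⟩
  have ml : l' ∈ Ioo l r := ⟨hl'.1, hl'.2.trans hlr.2⟩
  have mr : r' ∈ Ioo l r := ⟨hlr.1.trans hr'.1, hr'.2⟩
  have hl := hIcc l' ml
  have hr := hIcc r' mr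
  -- The values 0 and 1 would be local extrema, which strict monotonicity near `p` excludes.
  rcases hg.mono_or_anti with h | h
  · exact ⟨hl.1.trans_lt (h ml hlr hl'.2), (h hlr mr hr'.1).trans_le hr.2⟩
  · exact ⟨hr.1.trans_lt (h hlr mr hr'.1), (h ml hlr hl'.2).trans_le hl.2⟩

/-- The case `n = 0` is excluded because the identity preserves cross-ratios instead of strictly
expanding them. -/
theorem expandsCrossRatio_iterate (hf : IsPiecewiseNegSchwarzian f C) {J : Set ℝ}
    (hJ : J.OrdConnected) {n : ℕ} (hJC : ∀ k < n, MapsTo f^[k] J (openDom C))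
    (hn : n ≠ 0) : ExpandsCrossRatio f^[n] J := by
  induction n with
  | zero => exact absurd rfl hn
  | succ n ih =>
    rcases Nat.eq_zero_or_pos n with rfl | hpos
    · exact hf.expandsCrossRatio hJ fun x hx => hJC 0 (by norm_num) hx
    · have h := ih (fun k hk => hJC k (by omega)) hpos.ne'
      rw [Function.iterate_succ']
      exact (hf.expandsCrossRatio (h.ordConnected_image hJ)
        (hJC n (by omega)).image_subset).comp h

end IsPiecewiseNegSchwarzian

/-! ### Lateral points as one-sided germs. -/

/-- The one-sided neighbourhood filter of a lateral point `p ± i`. -/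
noncomputable def lateralFilter (α : ℂ) : Filter ℝ := if α.im < 0 then 𝓝[<] α.re else 𝓝[>] α.re

instance lateralFilter_neBot (α : ℂ) : (lateralFilter α).NeBot := by
  unfold lateralFilter
  split_ifs <;> infer_instance

theorem lateralFilter_le_nhds (α : ℂ) : lateralFilter α ≤ 𝓝 α.re := by
  unfold lateralFilter
  split_ifs <;> exact nhdsWithin_le_nhds

/-- A limit determines the real part, and a sequence cannot eventually lie on both sides of it. This
later shows that an attracting lateral point is periodic. -/
theorem eq_of_tendsto_lateralFilter {ι : Type*} {F : Filter ι} [F.NeBot] {g : ι → ℝ} {α β : ℂ}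
    (hα : α ∈ lateralPoints) (hβ : β ∈ lateralPoints) (h1 : Tendsto g F (lateralFilter α))
    (h2 : Tendsto g F (lateralFilter β)) : α = β := by
  have hre : α.re = β.re := tendsto_nhds_unique (h1.mono_right (lateralFilter_le_nhds α))
    (h2.mono_right (lateralFilter_le_nhds β))
  refine Complex.ext hre ?_
  rcases hα with ⟨hα, -⟩ | ⟨hα, -⟩ <;> rcases hβ with ⟨hβ, -⟩ | ⟨hβ, -⟩ <;>
    rw [hα, hβ] <;> exfalso <;> simp only [lateralFilter, hα, hβ, hre] at h1 h2 <;>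
    norm_num at h1 h2
  · obtain ⟨i, h3, h4⟩ := ((h1.eventually self_mem_nhdsWithin).and
      (h2.eventually self_mem_nhdsWithin)).exists
    exact lt_asymm (mem_Iio.1 h3) h4
  · obtain ⟨i, h3, h4⟩ := ((h1.eventually self_mem_nhdsWithin).and
      (h2.eventually self_mem_nhdsWithin)).exists
    exact lt_asymm (mem_Ioi.1 h3) h4

section OneSidedLimits

variable {f : ℝ → ℝ} {l r : ℝ}

/-- The limit is a supremum that strict monotonicity prevents from being attained, so it is
approached from one side only. That side is what the imaginary part of `lateralMap` records. The
decreasing versions apply this and its mirror image to `1 - f`. -/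
theorem exists_tendsto_nhdsLT_of_strictMonoOn (hlr : l < r) (hm : MapsTo f (Ioo l r) (Ioo 0 1))
    (h : StrictMonoOn f (Ioo l r)) : ∃ L ∈ Ioc (0 : ℝ) 1, Tendsto f (𝓝[<] r) (𝓝[<] L) := by
  have hne : (Ioo l r).Nonempty := nonempty_Ioo.2 hlr
  have hb : BddAbove (f '' Ioo l r) := ⟨1, by rintro _ ⟨x, hx, rfl⟩; exact (hm hx).2.le⟩
  have hlt : ∀ x ∈ Ioo l r, f x < sSup (f '' Ioo l r) := fun x hx => by
    obtain ⟨y, hy⟩ := exists_between hx.2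
    have hyI : y ∈ Ioo l r := ⟨hx.1.trans hy.1, hy.2⟩
    exact (h hx hyI hy.1).trans_le (le_csSup hb (mem_image_of_mem f hyI))
  refine ⟨sSup (f '' Ioo l r), ⟨?_, ?_⟩, ?_⟩
  · obtain ⟨x, hx⟩ := hne
    exact (hm hx).1.trans (hlt x hx)
  · exact csSup_le (hne.image f) (by rintro _ ⟨x, hx, rfl⟩; exact (hm hx).2.le)
  · refine tendsto_nhdsWithin_iff.2
      ⟨h.monotoneOn.tendsto_nhdsWithin_Ioo_left hne hb, ?_⟩
    filter_upwards [Ioo_mem_nhdsLT hlr] with x hx using hlt x hx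

theorem exists_tendsto_nhdsGT_of_strictMonoOn (hlr : l < r) (hm : MapsTo f (Ioo l r) (Ioo 0 1))
    (h : StrictMonoOn f (Ioo l r)) : ∃ L ∈ Ico (0 : ℝ) 1, Tendsto f (𝓝[>] l) (𝓝[>] L) := by
  have hne : (Ioo l r).Nonempty := nonempty_Ioo.2 hlr
  have hb : BddBelow (f '' Ioo l r) := ⟨0, by rintro _ ⟨x, hx, rfl⟩; exact (hm hx).1.le⟩
  have hlt : ∀ x ∈ Ioo l r, sInf (f '' Ioo l r) < f x := fun x hx => by
    obtain ⟨y, hy⟩ := exists_between hx.1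
    have hyI : y ∈ Ioo l r := ⟨hy.1, hy.2.trans hx.2⟩
    exact (csInf_le hb (mem_image_of_mem f hyI)).trans_lt (h hyI hx hy.2)
  refine ⟨sInf (f '' Ioo l r), ⟨?_, ?_⟩, ?_⟩
  · exact le_csInf (hne.image f) (by rintro _ ⟨x, hx, rfl⟩; exact (hm hx).1.le)
  · obtain ⟨x, hx⟩ := hne
    exact (hlt x hx).trans (hm hx).2
  · refine tendsto_nhdsWithin_iff.2
      ⟨h.monotoneOn.tendsto_nhdsWithin_Ioo_right hne hb, ?_⟩
    filter_upwards [Ioo_mem_nhdsGT hlr] with x hx using hlt x hx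

theorem tendsto_nhdsGT_of_one_sub {F : Filter ℝ} {L : ℝ}
    (h : Tendsto (fun x => 1 - f x) F (𝓝[<] L)) : Tendsto f F (𝓝[>] (1 - L)) := by
  rw [tendsto_nhdsWithin_iff] at h ⊢
  refine ⟨by simpa using h.1.const_sub 1, ?_⟩
  filter_upwards [h.2] with x hx
  simp only [mem_Iio, mem_Ioi] at hx ⊢
  linarith

theorem tendsto_nhdsLT_of_one_sub {F : Filter ℝ} {L : ℝ}
    (h : Tendsto (fun x => 1 - f x) F (𝓝[>] L)) : Tendsto f F (𝓝[<] (1 - L)) := by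
  rw [tendsto_nhdsWithin_iff] at h ⊢
  refine ⟨by simpa using h.1.const_sub 1, ?_⟩
  filter_upwards [h.2] with x hx
  simp only [mem_Iio, mem_Ioi] at hx ⊢
  linarith

theorem exists_tendsto_nhdsLT_of_strictAntiOn (hlr : l < r) (hm : MapsTo f (Ioo l r) (Ioo 0 1))
    (h : StrictAntiOn f (Ioo l r)) : ∃ L ∈ Ico (0 : ℝ) 1, Tendsto f (𝓝[<] r) (𝓝[>] L) := by
  obtain ⟨L, hL, ht⟩ := exists_tendsto_nhdsLT_of_strictMonoOn (f := fun x => 1 - f x) hlr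
    (fun x hx => ⟨by linarith [(hm hx).2], by linarith [(hm hx).1]⟩)
    (fun x hx y hy hxy => by linarith [h hx hy hxy])
  exact ⟨1 - L, ⟨by linarith [hL.2], by linarith [hL.1]⟩, tendsto_nhdsGT_of_one_sub ht⟩

theorem exists_tendsto_nhdsGT_of_strictAntiOn (hlr : l < r) (hm : MapsTo f (Ioo l r) (Ioo 0 1))
    (h : StrictAntiOn f (Ioo l r)) : ∃ L ∈ Ioc (0 : ℝ) 1, Tendsto f (𝓝[>] l) (𝓝[<] L) := by
  obtain ⟨L, hL, ht⟩ := exists_tendsto_nhdsGT_of_strictMonoOn (f := fun x => 1 - f x) hlr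
    (fun x hx => ⟨by linarith [(hm hx).2], by linarith [(hm hx).1]⟩)
    (fun x hx y hy hxy => by linarith [h hx hy hxy])
  exact ⟨1 - L, ⟨by linarith [hL.2], by linarith [hL.1]⟩, tendsto_nhdsLT_of_one_sub ht⟩

theorem limUnder_sign_eq {F : Filter ℝ} [F.NeBot] {s : Set ℝ} (hs : s ∈ F)
    (hpos : ∀ p ∈ s, 0 < deriv f p) : limUnder F (fun x => deriv f x / |deriv f x|) = 1 := by
  refine (tendsto_const_nhds.congr' ?_).limUnder_eq
  filter_upwards [hs] with x hx
  rw [abs_of_pos (hpos x hx), div_self (hpos x hx).ne']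

theorem limUnder_sign_eq_neg {F : Filter ℝ} [F.NeBot] {s : Set ℝ} (hs : s ∈ F)
    (hneg : ∀ p ∈ s, deriv f p < 0) : limUnder F (fun x => deriv f x / |deriv f x|) = -1 := by
  refine (tendsto_const_nhds.congr' ?_).limUnder_eq
  filter_upwards [hs] with x hx
  rw [abs_of_neg (hneg x hx), div_neg, div_self (hneg x hx).ne]

end OneSidedLimits

/-! ### Domains of iterates and full branches over (a, b). -/

/-- The set of points that can be iterated `n` times in `(0,1) ∖ C`. -/
def iterDom (f : ℝ → ℝ) (C : Set ℝ) (n : ℕ) : Set ℝ := {x | ∀ k < n, f^[k] x ∈ openDom C}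

/-- The set of points whose forward orbit stays in `(0,1) ∖ C`. -/
def stableDom (f : ℝ → ℝ) (C : Set ℝ) : Set ℝ := {x | ∀ k, f^[k] x ∈ openDom C}

namespace IsPiecewiseNegSchwarzian

theorem openDom_mem_nhdsLT (hf : IsPiecewiseNegSchwarzian f C) {p : ℝ} (hp : p ∈ Ioc (0 : ℝ) 1) :
    openDom C ∈ 𝓝[<] p := by
  have h1 : (C \ {p})ᶜ ∈ 𝓝 p :=
    (hf.finite_exceptional.subset sdiff_subset).isClosed.isOpen_compl.mem_nhds (by simp)
  filter_upwards [mem_nhdsWithin_of_mem_nhds h1, mem_nhdsWithin_of_mem_nhds (Ioi_mem_nhds hp.1),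
    self_mem_nhdsWithin] with x hx hx0 hxp
  exact ⟨⟨hx0, (mem_Iio.1 hxp).trans_le hp.2⟩, fun hC => hx ⟨hC, (mem_Iio.1 hxp).ne⟩⟩

theorem openDom_mem_nhdsGT (hf : IsPiecewiseNegSchwarzian f C) {p : ℝ} (hp : p ∈ Ico (0 : ℝ) 1) :
    openDom C ∈ 𝓝[>] p := by
  have h1 : (C \ {p})ᶜ ∈ 𝓝 p :=
    (hf.finite_exceptional.subset sdiff_subset).isClosed.isOpen_compl.mem_nhds (by simp)
  filter_upwards [mem_nhdsWithin_of_mem_nhds h1, mem_nhdsWithin_of_mem_nhds (Iio_mem_nhds hp.2),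
    self_mem_nhdsWithin] with x hx hx0 hxp
  exact ⟨⟨hp.1.trans_lt (mem_Ioi.1 hxp), hx0⟩, fun hC => hx ⟨hC, (mem_Ioi.1 hxp).ne'⟩⟩

/-- The lateral map sends lateral points to lateral points and describes the action of `f` on
one-sided germs. -/
theorem lateralMap_spec (hf : IsPiecewiseNegSchwarzian f C) {α : ℂ} (hα : α ∈ lateralPoints) :
    lateralMap f α ∈ lateralPoints ∧
      Tendsto f (lateralFilter α) (lateralFilter (lateralMap f α)) := by
  rcases hα with ⟨him, hre⟩ | ⟨him, hre⟩
  · have hneg : α.im < 0 := by rw [him]; norm_num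
    obtain ⟨l, hl, hsub⟩ := (mem_nhdsLT_iff_exists_Ioo_subset).1 (hf.openDom_mem_nhdsLT hre)
    have hlr : l < α.re := hl
    have hs : Ioo l α.re ∈ 𝓝[<] α.re := Ioo_mem_nhdsLT hlr
    have hm : MapsTo f (Ioo l α.re) (Ioo 0 1) := fun x hx => hf.mapsTo_Ioo (hsub hx)
    simp only [lateralMap, if_pos hneg]
    -- On a one-sided neighbourhood without exceptional points the sign of `f'` is constant and `f`
    -- is monotone, so both `limUnder` values are genuine limits.
    rcases hf.deriv_pos_or_neg ordConnected_Ioo hsub with h | h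
    · obtain ⟨L, hL, ht⟩ := exists_tendsto_nhdsLT_of_strictMonoOn hlr hm
        (hf.strictMonoOn_of_deriv_pos ordConnected_Ioo hsub h)
      rw [limUnder_sign_eq hs h, (ht.mono_right nhdsWithin_le_nhds).limUnder_eq]
      exact ⟨Or.inl ⟨rfl, hL⟩, by simpa [lateralFilter, hneg, not_lt.2 (zero_le_one' ℝ)] using ht⟩
    · obtain ⟨L, hL, ht⟩ := exists_tendsto_nhdsLT_of_strictAntiOn hlr hm
        (hf.strictAntiOn_of_deriv_neg ordConnected_Ioo hsub h)
      rw [limUnder_sign_eq_neg hs h, (ht.mono_right nhdsWithin_le_nhds).limUnder_eq]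
      exact ⟨Or.inr ⟨by norm_num, hL⟩,
        by simpa [lateralFilter, hneg, not_lt.2 (zero_le_one' ℝ)] using ht⟩
  · have hneg : ¬ α.im < 0 := by rw [him]; norm_num
    obtain ⟨l, hl, hsub⟩ := (mem_nhdsGT_iff_exists_Ioo_subset).1 (hf.openDom_mem_nhdsGT hre)
    have hlr : α.re < l := hl
    have hs : Ioo α.re l ∈ 𝓝[>] α.re := Ioo_mem_nhdsGT hlr
    have hm : MapsTo f (Ioo α.re l) (Ioo 0 1) := fun x hx => hf.mapsTo_Ioo (hsub hx)
    simp only [lateralMap, if_neg hneg]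
    rcases hf.deriv_pos_or_neg ordConnected_Ioo hsub with h | h
    · obtain ⟨L, hL, ht⟩ := exists_tendsto_nhdsGT_of_strictMonoOn hlr hm
        (hf.strictMonoOn_of_deriv_pos ordConnected_Ioo hsub h)
      rw [limUnder_sign_eq hs h, (ht.mono_right nhdsWithin_le_nhds).limUnder_eq]
      exact ⟨Or.inr ⟨rfl, hL⟩, by simpa [lateralFilter, hneg, not_lt.2 (zero_le_one' ℝ)] using ht⟩
    · obtain ⟨L, hL, ht⟩ := exists_tendsto_nhdsGT_of_strictAntiOn hlr hm
        (hf.strictAntiOn_of_deriv_neg ordConnected_Ioo hsub h)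
      rw [limUnder_sign_eq_neg hs h, (ht.mono_right nhdsWithin_le_nhds).limUnder_eq]
      exact ⟨Or.inl ⟨rfl, hL⟩, by simpa [lateralFilter, hneg, not_lt.2 (zero_le_one' ℝ)] using ht⟩

theorem lateralMap_iterate_spec (hf : IsPiecewiseNegSchwarzian f C) {α : ℂ}
    (hα : α ∈ lateralPoints) (n : ℕ) : (lateralMap f)^[n] α ∈ lateralPoints ∧
      Tendsto f^[n] (lateralFilter α) (lateralFilter ((lateralMap f)^[n] α)) := by
  induction n with
  | zero => exact ⟨hα, tendsto_id⟩
  | succ n ih =>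
    rw [Function.iterate_succ', Function.iterate_succ']
    have := hf.lateralMap_spec ih.1
    exact ⟨this.1, this.2.comp ih.2⟩

/-- As long as the orbit stays in `openDom C`, `f` is continuous along it and one-sided limits are
values. -/
theorem lateralMap_iterate_re (hf : IsPiecewiseNegSchwarzian f C) {α : ℂ}
    (hα : α ∈ lateralPoints) {n : ℕ} (h : α.re ∈ iterDom f C n) :
    ((lateralMap f)^[n] α).re = f^[n] α.re := by
  induction n with
  | zero => rfl
  | succ n ih =>
    have h1 := ih fun k hk => h k (by omega)
    have h2 := hf.lateralMap_iterate_spec hα n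
    rw [Function.iterate_succ_apply', Function.iterate_succ_apply']
    have h3 := (hf.lateralMap_spec h2.1).2.mono_right (lateralFilter_le_nhds _)
    have h4 : ContinuousAt f (((lateralMap f)^[n] α).re) := by
      rw [h1]; exact (hf.hasDerivAt (h n (by omega))).continuousAt
    have h5 := tendsto_nhds_unique h3 (h4.tendsto.mono_left (lateralFilter_le_nhds _))
    rw [h5, h1]

/-- The lateral orbit of a point that meets the exceptional set before time `n` is at time `n`
in the orbit of a lateral exceptional value. -/
theorem lateralMap_iterate_re_mem (hf : IsPiecewiseNegSchwarzian f C) {α : ℂ}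
    (hα : α ∈ lateralPoints) {n : ℕ} (h0 : α.re ∈ Ioo (0 : ℝ) 1) (h : α.re ∉ iterDom f C n) :
    ((lateralMap f)^[n] α).re ∈ exceptionalValueOrbits f C := by
  classical
  have hex : ∃ k, k < n ∧ f^[k] α.re ∉ openDom C := by
    simpa [iterDom] using h
  obtain ⟨hin, hi⟩ := Nat.find_spec hex
  set i := Nat.find hex
  have hlt : α.re ∈ iterDom f C i := fun k hk => by
    by_contra hcon
    exact Nat.find_min hex hk ⟨hk.trans hin, hcon⟩
  have hre := hf.lateralMap_iterate_re hα hlt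
  -- At the first exit time `i` the orbit is still in (0,1), so it can only have hit `C`.
  have hIoo : f^[i] α.re ∈ Ioo (0 : ℝ) 1 := by
    rcases Nat.eq_zero_or_pos i with h1 | h1
    · rw [h1]; exact h0
    · obtain ⟨j, hj⟩ := Nat.exists_eq_succ_of_ne_zero h1.ne'
      rw [hj, Function.iterate_succ_apply']
      exact hf.mapsTo_Ioo (hlt j (by omega))
  have hC : f^[i] α.re ∈ C := by
    by_contra hcon
    exact hi ⟨hIoo, hcon⟩
  refine ⟨(lateralMap f)^[i] α, ⟨f^[i] α.re, hC, ?_⟩, n - i, by omega, ?_⟩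
  · rcases (hf.lateralMap_iterate_spec hα i).1 with ⟨him, -⟩ | ⟨him, -⟩
    · exact Or.inl (Complex.ext (by simp [hre]) (by simp [him]))
    · exact Or.inr (Complex.ext (by simp [hre]) (by simp [him]))
  · rw [← Function.iterate_add_apply]
    congr 3
    omega

theorem isOpen_iterDom (hf : IsPiecewiseNegSchwarzian f C) (n : ℕ) : IsOpen (iterDom f C n) := by
  induction n with
  | zero => simp [iterDom]
  | succ n ih =>
    have : iterDom f C (n + 1) = openDom C ∩ f ⁻¹' iterDom f C n := by
      ext x
      refine ⟨fun h => ⟨h 0 (by omega), fun k hk => by simpa using h (k + 1) (by omega)⟩,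
        fun h k hk => ?_⟩
      rcases k with _ | k
      · exact h.1
      · exact h.2 k (by omega)
    rw [this]
    exact hf.continuousOn_openDom.isOpen_inter_preimage hf.isOpen_openDom ih

theorem expandsCrossRatio_iterDom (hf : IsPiecewiseNegSchwarzian f C) {J : Set ℝ}
    (hJ : J.OrdConnected) {n : ℕ} (hJC : J ⊆ iterDom f C n) (hn : n ≠ 0) :
    ExpandsCrossRatio f^[n] J :=
  hf.expandsCrossRatio_iterate hJ (fun k hk _ hx => hJC hx k hk) hn

/-- Around a point which is separated on both sides from the end points of `[0,1]` by points where
`f^n` is not defined, `f^n` maps a suitable interval over every interval that contains the image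
of the point and avoids the orbits of the lateral exceptional values. -/
theorem exists_Ioo_subset_image (hf : IsPiecewiseNegSchwarzian f C) {a b x u v : ℝ} {n : ℕ}
    (hdisj : Ioo a b ∩ exceptionalValueOrbits f C = ∅) (hn : n ≠ 0) (hx : x ∈ iterDom f C n)
    (hxI : f^[n] x ∈ Ioo a b) (hu : u ∉ iterDom f C n) (hv : v ∉ iterDom f C n) (hu0 : 0 < u)
    (hux : u < x) (hxv : x < v) (hv1 : v < 1) :
    ∃ u' v', u ≤ u' ∧ u' < x ∧ x < v' ∧ v' ≤ v ∧ Ioo u' v' ⊆ iterDom f C n ∧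
      u' ∉ iterDom f C n ∧ v' ∉ iterDom f C n ∧ Ioo a b ⊆ f^[n] '' Ioo u' v' := by
  have hO := hf.isOpen_iterDom n
  -- `u'` and `v'` are the ends of the component of `iterDom f C n` around `x`. They lie in (0,1),
  -- so they are cut off by preimages of `C` and not by 0 or 1.
  obtain ⟨u', hu', hu'max⟩ := (isCompact_Icc.diff hO :
    IsCompact (Icc u x \ iterDom f C n)).exists_isGreatest ⟨u, left_mem_Icc.2 hux.le, hu⟩
  obtain ⟨v', hv', hv'min⟩ := (isCompact_Icc.diff hO :
    IsCompact (Icc x v \ iterDom f C n)).exists_isLeast ⟨v, right_mem_Icc.2 hxv.le, hv⟩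
  have hu'x : u' < x := lt_of_le_of_ne hu'.1.2 (by rintro rfl; exact hu'.2 hx)
  have hxv' : x < v' := lt_of_le_of_ne hv'.1.1 (by rintro rfl; exact hv'.2 hx)
  have hsub : Ioo u' v' ⊆ iterDom f C n := by
    intro y hy
    by_contra hcon
    rcases le_total y x with h | h
    · exact (hu'max ⟨⟨hu'.1.1.trans hy.1.le, h⟩, hcon⟩).not_gt hy.1
    · exact (hv'min ⟨⟨h, hy.2.le.trans hv'.1.2⟩, hcon⟩).not_gt hy.2
  refine ⟨u', v', hu'.1.1, hu'x, hxv', hv'.1.2, hsub, hu'.2, hv'.2, ?_⟩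
  have hg := hf.expandsCrossRatio_iterDom ordConnected_Ioo hsub hn
  set g := f^[n]
  have hu'0 : u' ∈ Ioo (0 : ℝ) 1 := ⟨hu0.trans_le hu'.1.1, by linarith⟩
  have hv'0 : v' ∈ Ioo (0 : ℝ) 1 := ⟨by linarith [hu'0.1], hv'.1.2.trans_lt hv1⟩
  have hα : (⟨u', 1⟩ : ℂ) ∈ lateralPoints := Or.inr ⟨rfl, hu'0.1.le, hu'0.2⟩
  have hβ : (⟨v', -1⟩ : ℂ) ∈ lateralPoints := Or.inl ⟨rfl, hv'0.1, hv'0.2.le⟩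
  obtain ⟨q, hqE, hq⟩ : ∃ q ∈ exceptionalValueOrbits f C, Tendsto g (𝓝[>] u') (𝓝 q) :=
    ⟨_, hf.lateralMap_iterate_re_mem hα hu'0 hu'.2, by
      have := (hf.lateralMap_iterate_spec hα n).2.mono_right (lateralFilter_le_nhds _)
      rwa [show lateralFilter ⟨u', 1⟩ = 𝓝[>] u' by simp [lateralFilter]] at this⟩
  obtain ⟨q', hqE', hq'⟩ : ∃ q ∈ exceptionalValueOrbits f C, Tendsto g (𝓝[<] v') (𝓝 q) :=
    ⟨_, hf.lateralMap_iterate_re_mem hβ hv'0 hv'.2, by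
      have := (hf.lateralMap_iterate_spec hβ n).2.mono_right (lateralFilter_le_nhds _)
      rwa [show lateralFilter ⟨v', -1⟩ = 𝓝[<] v' by simp [lateralFilter]] at this⟩
  -- The end limits avoid (a, b) while `g x` lies in it, so by monotonicity they lie on opposite
  -- sides of (a, b).
  have hqI : q ∉ Ioo a b := fun h => (hdisj.subset ⟨h, hqE⟩ : _)
  have hqI' : q' ∉ Ioo a b := fun h => (hdisj.subset ⟨h, hqE'⟩ : _)
  have hxV : x ∈ Ioo u' v' := ⟨hu'x, hxv'⟩
  have evl : ∀ᶠ y in 𝓝[>] u', y ∈ Ioo u' x := Ioo_mem_nhdsGT hu'x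
  have evr : ∀ᶠ y in 𝓝[<] v', y ∈ Ioo x v' := Ioo_mem_nhdsLT hxv'
  have hS := hg.ordConnected_image ordConnected_Ioo
  intro y hy
  rcases hg.mono_or_anti with h | h
  · have h1 : q ≤ g x := le_of_tendsto hq (evl.mono fun z hz =>
      (h ⟨hz.1, hz.2.trans hxv'⟩ hxV hz.2).le)
    have h2 : g x ≤ q' := ge_of_tendsto hq' (evr.mono fun z hz =>
      (h hxV ⟨hu'x.trans hz.1, hz.2⟩ hz.1).le)
    have h3 : q ≤ a := not_lt.1 fun hc => hqI ⟨hc, h1.trans_lt hxI.2⟩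
    have h4 : b ≤ q' := not_lt.1 fun hc => hqI' ⟨hxI.1.trans_le h2, hc⟩
    obtain ⟨z, hz, hz'⟩ := (evl.and (hq.eventually_lt_const (h3.trans_lt hy.1))).exists
    obtain ⟨w, hw, hw'⟩ := (evr.and (hq'.eventually_const_lt (hy.2.trans_le h4))).exists
    exact hS.out (mem_image_of_mem g ⟨hz.1, hz.2.trans hxv'⟩)
      (mem_image_of_mem g ⟨hu'x.trans hw.1, hw.2⟩) ⟨hz'.le, hw'.le⟩
  · have h1 : g x ≤ q := ge_of_tendsto hq (evl.mono fun z hz =>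
      (h ⟨hz.1, hz.2.trans hxv'⟩ hxV hz.2).le)
    have h2 : q' ≤ g x := le_of_tendsto hq' (evr.mono fun z hz =>
      (h hxV ⟨hu'x.trans hz.1, hz.2⟩ hz.1).le)
    have h3 : q' ≤ a := not_lt.1 fun hc => hqI' ⟨hc, h2.trans_lt hxI.2⟩
    have h4 : b ≤ q := not_lt.1 fun hc => hqI ⟨hxI.1.trans_le h1, hc⟩
    obtain ⟨z, hz, hz'⟩ := (evl.and (hq.eventually_const_lt (hy.2.trans_le h4))).exists
    obtain ⟨w, hw, hw'⟩ := (evr.and (hq'.eventually_lt_const (h3.trans_lt hy.1))).exists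
    exact hS.out (mem_image_of_mem g ⟨hu'x.trans hw.1, hw.2⟩)
      (mem_image_of_mem g ⟨hz.1, hz.2.trans hxv'⟩) ⟨hw'.le, hz'.le⟩

end IsPiecewiseNegSchwarzian

/-! ### Omega-limit sets, periodic-like basins and preperiodic points. -/

theorem iterate_mem_stableDom {x : ℝ} (hx : x ∈ stableDom f C) (m : ℕ) :
    f^[m] x ∈ stableDom f C := fun k => by
  rw [← Function.iterate_add_apply]
  exact hx _

theorem stableDom_subset_iterDom (n : ℕ) : stableDom f C ⊆ iterDom f C n := fun _ hx k _ => hx k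

theorem stableDom_subset_Ioo : stableDom f C ⊆ Ioo 0 1 := fun _ hx => (hx 0).1

theorem frequently_of_mem_omegaSet {x y : ℝ} (hy : y ∈ omegaSet f C x) {s : Set ℝ}
    (hs : s ∈ 𝓝 y) : ∃ᶠ n in atTop, f^[n] x ∈ s := by
  obtain ⟨-, n, hn, ht⟩ := hy
  exact hn.frequently (ht.eventually hs).frequently

theorem mem_omegaSet_iff {x : ℝ} (hx : x ∈ stableDom f C) {y : ℝ} :
    y ∈ omegaSet f C x ↔ ∀ s ∈ 𝓝 y, ∃ᶠ n in atTop, f^[n] x ∈ s := by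
  refine ⟨fun h s hs => frequently_of_mem_omegaSet h hs, fun h => ⟨fun n => (hx n).2, ?_⟩⟩
  obtain ⟨ψ, hψ, ht⟩ := (mapClusterPt_iff_frequently.2 h).tendsto_subseq
  exact ⟨ψ, hψ.tendsto_atTop, ht⟩

theorem omegaSet_iterate {x : ℝ} (hx : x ∈ stableDom f C) (m : ℕ) :
    omegaSet f C (f^[m] x) = omegaSet f C x := by
  ext y
  rw [mem_omegaSet_iff hx, mem_omegaSet_iff (iterate_mem_stableDom hx m)]
  refine forall₂_congr fun s _ => ?_
  simp only [← Function.iterate_add_apply]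
  conv_rhs => rw [← map_add_atTop_eq_nat m]
  rfl

theorem mem_periodicLikeBasin_iterate {x : ℝ} (hx : x ∈ stableDom f C) (m : ℕ) :
    f^[m] x ∈ periodicLikeBasin f C ↔ x ∈ periodicLikeBasin f C := by
  simp only [periodicLikeBasin, basin, mem_ofPred_eq, omegaSet_iterate hx m]
  have h1 : x ∈ Icc (0 : ℝ) 1 := Ioo_subset_Icc_self (hx 0).1
  have h2 : f^[m] x ∈ Icc (0 : ℝ) 1 := Ioo_subset_Icc_self (hx m).1
  simp only [h1, h2, true_and]

theorem continuousOn_iterate (hf : IsPiecewiseNegSchwarzian f C) {n : ℕ} :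
    ContinuousOn f^[n] (iterDom f C n) := by
  induction n with
  | zero => exact continuousOn_id
  | succ n ih =>
    rw [Function.iterate_succ']
    exact hf.continuousOn_openDom.comp (ih.mono fun x hx k hk => hx k (by omega))
      fun x hx => hx n (by omega)

/-- A positive measure set of points attracted to a lateral point is in the basin of a
periodic-like attractor. -/
theorem mem_periodicLikeBasin_of_tendsto (hf : IsPiecewiseNegSchwarzian f C) {α : ℂ}
    (hα : α ∈ lateralPoints) {k : ℕ} (hk : 0 < k) {S : Set ℝ} (hS : S ⊆ stableDom f C)
    (hvol : volume S ≠ 0)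
    (ht : ∀ z ∈ S, Tendsto (fun i => f^[k * i] z) atTop (lateralFilter α)) {y : ℝ} (hy : y ∈ S) :
    y ∈ periodicLikeBasin f C := by
  -- Applying `f^k` only shifts the sequence `f^(k i)(y)`, so its one-sided limit is both `α` and
  -- the image of `α`.
  have hper : (lateralMap f)^[k] α = α := by
    have h1 := hf.lateralMap_iterate_spec hα k
    refine eq_of_tendsto_lateralFilter h1.1 hα (h1.2.comp (ht y hy)) ?_
    have := (ht y hy).comp (tendsto_add_atTop_nat 1)
    refine this.congr fun i => ?_
    simp only [Function.comp]
    rw [← Function.iterate_add_apply]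
    congr 2
    ring
  set A : Set ℝ := {y | ∃ j : ℕ, y = ((lateralMap f)^[j] α).re} with hA
  have hlim : ∀ z ∈ S, ∀ r, Tendsto (fun i => f^[k * i + r] z) atTop
      (𝓝 ((lateralMap f)^[r] α).re) := by
    intro z hz r
    have h1 := (hf.lateralMap_iterate_spec hα r).2.comp (ht z hz)
    refine (h1.mono_right (lateralFilter_le_nhds _)).congr fun i => ?_
    simp only [Function.comp]
    rw [← Function.iterate_add_apply, add_comm]
  have hAfin : A.Finite := by
    refine ((finite_lt_nat k).image fun j => ((lateralMap f)^[j] α).re).subset ?_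
    rintro _ ⟨j, rfl⟩
    have hp : Function.IsPeriodicPt (lateralMap f) k α := hper
    exact ⟨j % k, Nat.mod_lt _ hk, by simp only [hp.iterate_mod_apply]⟩
  have homega : ∀ z ∈ S, omegaSet f C z = A := by
    intro z hz
    ext p
    rw [mem_omegaSet_iff (hS hz)]
    constructor
    · intro h
      by_contra hpA
      obtain ⟨ε, hε, hsub⟩ := Metric.nhds_basis_closedBall.mem_iff.1
        (hAfin.isClosed.isOpen_compl.mem_nhds hpA)
      have hev : ∀ᶠ i in atTop, ∀ r ∈ Finset.range k, f^[k * i + r] z ∉ Metric.closedBall p ε := by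
        rw [Filter.eventually_all_finset]
        intro r _
        exact (hlim z hz r).eventually (Metric.isClosed_closedBall.isOpen_compl.mem_nhds
          fun hc => hsub hc ⟨r, rfl⟩)
      obtain ⟨i₀, hi₀⟩ := eventually_atTop.1 hev
      refine h _ (Metric.closedBall_mem_nhds p hε) ?_
      filter_upwards [eventually_ge_atTop (k * i₀)] with n hn
      have := hi₀ (n / k) ((Nat.le_div_iff_mul_le hk).2 (by rwa [mul_comm]))
        (n % k) (Finset.mem_range.2 (Nat.mod_lt _ hk))
      rwa [Nat.div_add_mod] at this
    · rintro ⟨r, rfl⟩ s hs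
      have h1 : Tendsto (fun i => k * i + r) atTop atTop :=
        tendsto_atTop_mono (fun i => (Nat.le_mul_of_pos_left i hk).trans (Nat.le_add_right _ r))
          tendsto_id
      exact h1.frequently ((hlim z hz r).eventually hs).frequently
  have hbasin : S ⊆ basin f C A := fun z hz =>
    ⟨Ioo_subset_Icc_self (stableDom_subset_Ioo (hS hz)), (homega z hz).subset⟩
  refine ⟨A, ⟨⟨α, hα, ⟨k, hk, hper⟩, rfl⟩, ?_, hAfin.isCompact, ?_, ?_⟩, hbasin hy⟩
  · rintro _ ⟨j, rfl⟩
    rcases (hf.lateralMap_iterate_spec hα j).1 with h | h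
    · exact Ioc_subset_Icc_self h.2
    · exact Ico_subset_Icc_self h.2
  · exact (pos_iff_ne_zero.2 hvol).trans_le (measure_mono hbasin)
  -- Every point of `S` has omega-limit set exactly `A`, so the basin of a proper subset misses all
  -- of `S`.
  · rintro ⟨A', -, hA', hae⟩
    refine hvol (measure_mono_null ?_ (ae_eq_set.1 hae).2)
    intro z hz
    refine ⟨hbasin hz, fun h => hA'.2 ?_⟩
    have := h.2
    rwa [homega z hz] at this

/-- Points of the fundamental domain `[y, G y]` are trapped between consecutive terms of the
increasing orbit of `y`. A whole interval is thus attracted from the left, which supplies the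
positive measure that an attractor needs. -/
theorem exists_tendsto_nhdsLT_iterate {G : ℝ → ℝ} {H : Set ℝ} (hH : H ⊆ Ioo 0 1)
    (hoc : H.OrdConnected) (hm : MapsTo G H H) (hmono : StrictMonoOn G H) {y : ℝ} (hy : y ∈ H)
    (hlt : y < G y) : ∃ q ∈ Ioc (0 : ℝ) 1, ∀ z ∈ Icc y (G y),
      Tendsto (fun i => G^[i] z) atTop (𝓝[<] q) := by
  have hIH : Icc y (G y) ⊆ H := hoc.out hy (hm hy)
  have hmem : ∀ z ∈ H, ∀ i, G^[i] z ∈ H := fun z hz i => hm.iterate i hz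
  have hle : ∀ i, ∀ z ∈ H, ∀ w ∈ H, z ≤ w → G^[i] z ≤ G^[i] w := by
    intro i
    induction i with
    | zero => exact fun z _ w _ h => h
    | succ i ih =>
      intro z hz w hw h
      rw [Function.iterate_succ_apply', Function.iterate_succ_apply']
      exact hmono.monotoneOn (hmem z hz i) (hmem w hw i) (ih z hz w hw h)
  have hstep : ∀ i, G^[i] y < G^[i + 1] y := by
    intro i
    induction i with
    | zero => exact hlt
    | succ i ih =>
      rw [Function.iterate_succ_apply', Function.iterate_succ_apply' G (i + 1)]
      exact hmono (hmem y hy i) (hmem y hy (i + 1)) ih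
  have hsm : StrictMono fun i => G^[i] y := strictMono_nat_of_lt_succ hstep
  have hbdd : BddAbove (range fun i => G^[i] y) :=
    ⟨1, by rintro _ ⟨i, rfl⟩; exact (hH (hmem y hy i)).2.le⟩
  have hlim := tendsto_atTop_ciSup hsm.monotone hbdd
  set q := ⨆ i, G^[i] y
  have hltq : ∀ i, G^[i] y < q := fun i => (hstep i).trans_le (le_ciSup hbdd (i + 1))
  refine ⟨q, ⟨(hH hy).1.trans (hltq 0), ciSup_le fun i => (hH (hmem y hy i)).2.le⟩,
    fun z hz => tendsto_nhdsWithin_iff.2 ⟨?_, Eventually.of_forall fun i => ?_⟩⟩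
  · refine tendsto_of_tendsto_of_tendsto_of_le_of_le hlim
      ((tendsto_add_atTop_iff_nat 1).2 hlim) (fun i => hle i y hy z (hIH hz) hz.1) fun i => ?_
    have := hle i z (hIH hz) (G y) (hm hy) hz.2
    rwa [← Function.iterate_succ_apply] at this
  · have := hle i z (hIH hz) (G y) (hm hy) hz.2
    rw [← Function.iterate_succ_apply] at this
    exact this.trans_lt (hltq (i + 1))

theorem exists_tendsto_nhdsGT_iterate {G : ℝ → ℝ} {H : Set ℝ} (hH : H ⊆ Ioo 0 1)
    (hoc : H.OrdConnected) (hm : MapsTo G H H) (hmono : StrictMonoOn G H) {y : ℝ} (hy : y ∈ H)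
    (hlt : G y < y) : ∃ q ∈ Ico (0 : ℝ) 1, ∀ z ∈ Icc (G y) y,
      Tendsto (fun i => G^[i] z) atTop (𝓝[>] q) := by
  have hconj : ∀ i z, (fun t => 1 - G (1 - t))^[i] (1 - z) = 1 - G^[i] z := by
    intro i
    induction i with
    | zero => exact fun z => rfl
    | succ i ih =>
      intro z
      rw [Function.iterate_succ_apply', Function.iterate_succ_apply', ih, sub_sub_cancel]
  obtain ⟨q, hq, h⟩ := exists_tendsto_nhdsLT_iterate (G := fun t => 1 - G (1 - t))
    (H := (fun t => 1 - t) ⁻¹' H) (y := 1 - y)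
    (fun t ht => ⟨by linarith [(hH ht).2], by linarith [(hH ht).1]⟩)
    (hoc.preimage_anti fun s t hst => sub_le_sub_left hst 1)
    (fun t ht => by simpa using hm ht)
    (fun s hs t ht hst => by
      have := hmono ht hs (by linarith : 1 - t < 1 - s)
      simp only
      linarith)
    (by simpa using hy) (by simpa using hlt)
  refine ⟨1 - q, ⟨by linarith [hq.2], by linarith [hq.1]⟩, fun z hz => ?_⟩
  have h1 := h (1 - z) (by rw [sub_sub_cancel]; exact ⟨by linarith [hz.2], by linarith [hz.1]⟩)
  simp only [hconj] at h1
  rw [tendsto_nhdsWithin_iff] at h1 ⊢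
  refine ⟨by simpa using h1.1.const_sub 1, ?_⟩
  filter_upwards [h1.2] with x hx
  simp only [mem_Iio, mem_Ioi] at hx ⊢
  linarith

/-- The image under `f^m` of an interval contained in the stable domain. -/
theorem uIcc_iterate_subset (hf : IsPiecewiseNegSchwarzian f C) {x y : ℝ}
    (h : uIcc x y ⊆ stableDom f C) (m : ℕ) :
    uIcc (f^[m] x) (f^[m] y) ⊆ f^[m] '' uIcc x y := by
  have hc : ContinuousOn f^[m] (uIcc x y) :=
    (continuousOn_iterate hf).mono (h.trans (stableDom_subset_iterDom m))
  exact (isPreconnected_uIcc.image _ hc).ordConnected.uIcc_subset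
    (mem_image_of_mem _ left_mem_uIcc) (mem_image_of_mem _ right_mem_uIcc)

theorem uIcc_iterate_subset_stableDom (hf : IsPiecewiseNegSchwarzian f C) {x y : ℝ}
    (h : uIcc x y ⊆ stableDom f C) (m : ℕ) :
    uIcc (f^[m] x) (f^[m] y) ⊆ stableDom f C := by
  intro z hz
  obtain ⟨w, hw, rfl⟩ := uIcc_iterate_subset hf h m hz
  exact iterate_mem_stableDom (h hw) m

/-- If the interval between `y` and `f^k(y)` is stable then `y` is periodic or attracted to a
periodic-like attractor. -/
theorem mem_periodicLikeBasin_of_uIcc_subset (hf : IsPiecewiseNegSchwarzian f C) {y : ℝ} {k : ℕ}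
    (hk : 0 < k) (hsub : uIcc y (f^[k] y) ⊆ stableDom f C) (hne : f^[2 * k] y ≠ y) :
    y ∈ periodicLikeBasin f C := by
  set H := ordConnectedComponent (stableDom f C) y
  have hHQ : H ⊆ stableDom f C := ordConnectedComponent_subset
  have hoc : H.OrdConnected := inferInstance
  have hy : y ∈ H := self_mem_ordConnectedComponent.2 (hsub left_mem_uIcc)
  -- `f^k` maps the component of `y` into that of `f^k(y)`, which is the same component by `hsub`.
  have hmaps : MapsTo f^[k] H H := by
    intro z hz
    have h1 : f^[k] z ∈ ordConnectedComponent (stableDom f C) (f^[k] y) :=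
      uIcc_iterate_subset_stableDom hf hz k
    rwa [← ordConnectedComponent_eq hsub] at h1
  have hg := hf.expandsCrossRatio_iterDom hoc (hHQ.trans (stableDom_subset_iterDom k)) hk.ne'
  have h2 : f^[2 * k] = f^[k] ∘ f^[k] := by rw [two_mul, Function.iterate_add]
  have hmaps2 : MapsTo f^[2 * k] H H := by rw [h2]; exact hmaps.comp hmaps
  -- Doubling `k` makes the return map increasing even if `f^k` reverses orientation.
  have hmono : StrictMonoOn f^[2 * k] H := by
    rw [h2]
    rcases hg.mono_or_anti with h | h
    · exact fun a ha b hb hab => h (hmaps ha) (hmaps hb) (h ha hb hab)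
    · exact fun a ha b hb hab => h (hmaps hb) (hmaps ha) (h ha hb hab)
  have hH01 : H ⊆ Ioo 0 1 := hHQ.trans stableDom_subset_Ioo
  rcases lt_or_gt_of_ne hne with hlt | hlt
  · obtain ⟨q, hq, h⟩ := exists_tendsto_nhdsGT_iterate hH01 hoc hmaps2 hmono hy hlt
    refine mem_periodicLikeBasin_of_tendsto hf (α := ⟨q, 1⟩) (k := 2 * k) (Or.inr ⟨rfl, hq⟩)
      (by omega) ((hoc.out (hmaps2 hy) hy).trans hHQ) ?_ (fun z hz => ?_) (right_mem_Icc.2 hlt.le)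
    · simp [hlt]
    · have := h z hz
      simp only [← Function.iterate_mul] at this
      simpa [lateralFilter, not_lt.2 (zero_le_one' ℝ)] using this
  · obtain ⟨q, hq, h⟩ := exists_tendsto_nhdsLT_iterate hH01 hoc hmaps2 hmono hy hlt
    refine mem_periodicLikeBasin_of_tendsto hf (α := ⟨q, -1⟩) (k := 2 * k) (Or.inl ⟨rfl, hq⟩)
      (by omega) ((hoc.out hy (hmaps2 hy)).trans hHQ) ?_ (fun z hz => ?_) (left_mem_Icc.2 hlt.le)
    · simp [hlt]
    · have := h z hz
      simp only [← Function.iterate_mul] at this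
      simpa [lateralFilter] using this

/-- Almost no point is preperiodic. -/
theorem volume_preperiodic_eq_zero (hf : IsPiecewiseNegSchwarzian f C) :
    volume {x ∈ stableDom f C | ∃ m k, 0 < k ∧ f^[k] (f^[m] x) = f^[m] x} = 0 := by
  have key : ∀ m k, 0 < k → 
      volume {x ∈ stableDom f C | f^[k] (f^[m] x) = f^[m] x} = 0 := by
    intro m k hk
    refine measure_null_of_locally_null _ fun x hx => ?_
    obtain ⟨l, r, hlr, hsub⟩ := mem_nhds_iff_exists_Ioo_subset.1
      ((hf.isOpen_iterDom (m + k + 1)).mem_nhds (stableDom_subset_iterDom _ hx.1))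
    refine ⟨Ioo l r ∩ {x ∈ stableDom f C | f^[k] (f^[m] x) = f^[m] x},
      inter_comm (Ioo l r) _ ▸ inter_mem_nhdsWithin _ (Ioo_mem_nhds hlr.1 hlr.2), ?_⟩
    -- Injectivity is read off from `f^(m+1)`, because cross-ratio expansion is only available for
    -- positive exponents and `m` may be 0.
    have hinj : InjOn f^[m] (Ioo l r) := by
      have := (hf.expandsCrossRatio_iterDom (n := m + 1) ordConnected_Ioo
        (hsub.trans fun y hy j hj => hy j (by omega)) (by omega)).injOn
      rw [Function.iterate_succ'] at this
      exact this.of_comp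
    have hoc : (f^[m] '' Ioo l r).OrdConnected :=
      (isPreconnected_Ioo.image _ ((continuousOn_iterate hf).mono
        (hsub.trans fun y hy j hj => hy j (by omega)))).ordConnected
    have hg := hf.expandsCrossRatio_iterDom hoc (n := k) (by
      rintro _ ⟨y, hy, rfl⟩ j hj
      rw [← Function.iterate_add_apply]
      exact hsub hy _ (by omega)) hk.ne'
    refine Set.Finite.measure_zero (Set.Finite.of_finite_image
      (hg.finite_fixedPoints.subset ?_) (hinj.mono inter_subset_left)) _
    rintro _ ⟨z, hz, rfl⟩
    exact ⟨mem_image_of_mem _ hz.1, hz.2.2⟩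
  have : {x ∈ stableDom f C | ∃ m k, 0 < k ∧ f^[k] (f^[m] x) = f^[m] x} ⊆
      ⋃ (m : ℕ) (k : ℕ), {x ∈ stableDom f C | 0 < k ∧ f^[k] (f^[m] x) = f^[m] x} := by
    rintro x ⟨hx, m, k, h⟩
    exact mem_iUnion₂.2 ⟨m, k, hx, h⟩
  refine measure_mono_null this (measure_iUnion_null fun m => measure_iUnion_null fun k => ?_)
  by_cases hk : 0 < k
  · refine measure_mono_null ?_ (key m k hk)
    rintro x ⟨hx, -, h⟩
    exact ⟨hx, h⟩
  · simp [hk]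

/-! ### Koebe-type distortion estimates. -/

namespace ExpandsCrossRatio

variable {g : ℝ → ℝ} {V : Set ℝ}

theorem neg (hg : ExpandsCrossRatio g V) : ExpandsCrossRatio (fun x => -g x) V where
  mono_or_anti := hg.mono_or_anti.symm.imp (fun h => h.neg) (fun h => h.neg)
  continuousOn := hg.continuousOn.neg
  crossRatio_lt := fun x hx y hy z hz w hw hxy hyz hzw => by
    have := hg.crossRatio_lt x hx y hy z hz w hw hxy hyz hzw
    linarith

/-- An interval whose image is tiny compared with its distance to the boundary of the image of
the domain is itself tiny. -/
theorem sub_mul_le (hg : ExpandsCrossRatio g V) (hV : V ⊆ Ioo 0 1) {p δ y z : ℝ} (hδ : 0 < δ)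
    (hl : p - δ ∈ g '' V) (hr : p + δ ∈ g '' V) (hy : y ∈ V) (hz : z ∈ V) (hyz : y < z)
    (hyp : |g y - p| ≤ δ / 2) (hzp : |g z - p| ≤ δ / 2) :
    (z - y) * δ ≤ 8 * |g z - g y| := by
  wlog hmono : StrictMonoOn g V generalizing g p
  · have h1 := hg.mono_or_anti.resolve_left hmono
    have := this hg.neg (p := -p) (by
        obtain ⟨r, hr, hr'⟩ := hr
        exact ⟨r, hr, by simp only [hr']; ring⟩) (by
        obtain ⟨l, hl, hl'⟩ := hl
        exact ⟨l, hl, by simp only [hl']; ring⟩)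
      (by rw [← abs_neg]; convert hyp using 2; ring)
      (by rw [← abs_neg]; convert hzp using 2; ring) h1.neg
    rwa [← abs_neg, show -(-g z - -g y) = g z - g y by ring] at this
  obtain ⟨l, hlV, hl⟩ := hl
  obtain ⟨r, hrV, hr⟩ := hr
  rw [abs_le] at hyp hzp
  have hly : l < y := (hmono.lt_iff_lt hlV hy).1 (by linarith)
  have hzr : z < r := (hmono.lt_iff_lt hz hrV).1 (by linarith)
  have hgyz := hmono hy hz hyz
  have h := hg.crossRatio_lt l hlV y hy z hz r hrV hly hyz hzr
  rw [abs_of_pos (sub_pos.2 hgyz)]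
  have hrl : 0 < r - l := by linarith
  have hrl1 : r - l < 1 := by linarith [(hV hrV).2, (hV hlV).1]
  have h1 : δ / 2 ≤ g r - g y := by linarith
  have h2 : δ / 2 ≤ g z - g l := by linarith
  have h3 : g r - g l = 2 * δ := by linarith
  -- In the inequality for `l < y < z < r` the image gaps are at least `δ / 2`, the image of `[l,
  -- r]` has length `2 * δ`, and `z - l ≤ 1`. Cancelling `(r - l) * δ` leaves the constant 8.
  have h4 : (r - l) * (z - y) * (δ / 2 * (δ / 2)) ≤
      (r - l) * (z - y) * ((g r - g y) * (g z - g l)) := by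
    have : 0 < (r - l) * (z - y) := mul_pos hrl (by linarith)
    have : 0 ≤ g r - g y := by linarith
    gcongr
  have h5 : (r - y) * (z - l) ≤ (r - l) * 1 := by
    have : z - l ≤ 1 := by linarith
    have : 0 ≤ z - l := by linarith
    gcongr
  have h6 : (g r - g l) * (g z - g y) * ((r - y) * (z - l)) ≤
      2 * δ * (g z - g y) * ((r - l) * 1) := by
    rw [h3]
    have : 0 < 2 * δ * (g z - g y) := mul_pos (by linarith) (by linarith)
    gcongr
  have h7 : (r - l) * δ * ((z - y) * δ) < (r - l) * δ * (8 * (g z - g y)) := by linarith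
  exact (lt_of_mul_lt_mul_left h7 (by positivity)).le

/-- Follows from the identity `(w - x) * (z - y) + (w - z) * (y - x) = (w - y) * (z - x)` in domain
and image: when one cross-ratio grows, the complementary one shrinks. -/
theorem complementary_lt (hg : ExpandsCrossRatio g V) {x y z w : ℝ} (hx : x ∈ V) (hy : y ∈ V)
    (hz : z ∈ V) (hw : w ∈ V) (hxy : x < y) (hyz : y < z) (hzw : z < w) :
    (g w - g z) * (g y - g x) * ((w - y) * (z - x)) <
      (w - z) * (y - x) * ((g w - g y) * (g z - g x)) := by
  have := hg.crossRatio_lt x hx y hy z hz w hw hxy hyz hzw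
  linarith

/-- A Koebe principle: on the preimage of an interval that is well inside the image, the map is
Lipschitz with a constant that is inversely proportional to the length of the preimage. -/
theorem abs_sub_mul_le (hg : ExpandsCrossRatio g V) (hoc : V.OrdConnected)
    (hmono : StrictMonoOn g V) (hdiam : ∀ x ∈ V, ∀ y ∈ V, g x - g y ≤ 1) {l s t r η : ℝ}
    (hl : l ∈ V) (hr : r ∈ V) (hls : l < s) (hst : s < t) (htr : t < r) (hη : 0 < η)
    (h1 : η ≤ g s - g l) (h2 : η ≤ g r - g t) :
    ∀ x ∈ Icc s t, ∀ y ∈ Icc s t, |g x - g y| * (η * (t - s)) ≤ 2 * |x - y| := by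
  have hsub : Icc l r ⊆ V := hoc.out hl hr
  have hsV : s ∈ V := hsub ⟨hls.le, by linarith⟩
  have htV : t ∈ V := hsub ⟨by linarith, htr.le⟩
  have hV : ∀ x ∈ Icc s t, x ∈ V := fun x hx => hsub ⟨by linarith [hx.1], by linarith [hx.2]⟩
  have hprod : ∀ x ∈ V, ∀ y ∈ V, ∀ z ∈ V, ∀ w ∈ V, x < y → y < z → z < w →
      (g w - g y) * (g z - g x) ≤ 1 := by
    intro x hx y hy z hz w hw hxy hyz hzw
    have := hdiam w hw y hy
    have := hdiam z hz x hx
    have := hmono hy hw (hyz.trans hzw)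
    have := hmono hx hz (hxy.trans hyz)
    exact mul_le_one₀ (by linarith) (by linarith) (by linarith)
  -- In the left half the comparison points are `t` and `r`, because there `t - x ≥ (t - s) / 2`;
  -- this is the source of the factor 2. The right half uses `l` and `s` instead.
  have left : ∀ x ∈ Icc s t, ∀ y ∈ Icc s t, x < y → y ≤ (s + t) / 2 →
      (g y - g x) * (η * (t - s)) ≤ 2 * (y - x) := by
    intro x hx y hy hxy hym
    have hyt : y < t := by linarith
    have h := hg.complementary_lt (hV x hx) (hV y hy) htV hr hxy hyt htr
    have hp := hprod x (hV x hx) y (hV y hy) t htV r hr hxy hyt htr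
    have hgxy := hmono (hV x hx) (hV y hy) hxy
    have e1 : η * (g y - g x) * ((r - t) * ((t - s) / 2)) ≤
        (g r - g t) * (g y - g x) * ((r - y) * (t - x)) := by
      have : 0 ≤ g y - g x := by linarith
      have : 0 ≤ r - t := by linarith
      have : 0 ≤ (t - s) / 2 := by linarith
      have : (t - s) / 2 ≤ t - x := by linarith
      have : r - t ≤ r - y := by linarith
      have : 0 ≤ (g r - g t) * (g y - g x) := mul_nonneg (by linarith) (by linarith)
      gcongr
      linarith
    have e2 : (r - t) * (y - x) * ((g r - g y) * (g t - g x)) ≤ (r - t) * (y - x) * 1 := by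
      have : 0 ≤ (r - t) * (y - x) := mul_nonneg (by linarith) (by linarith)
      gcongr
    have e3 : (r - t) * ((g y - g x) * (η * (t - s))) < (r - t) * (2 * (y - x)) := by linarith
    exact (lt_of_mul_lt_mul_left e3 (by linarith)).le
  have right : ∀ x ∈ Icc s t, ∀ y ∈ Icc s t, x < y → (s + t) / 2 ≤ x →
      (g y - g x) * (η * (t - s)) ≤ 2 * (y - x) := by
    intro x hx y hy hxy hym
    have hyt : s < x := by linarith
    have h := hg.complementary_lt hl hsV (hV x hx) (hV y hy) hls hyt hxy
    have hp := hprod l hl s hsV x (hV x hx) y (hV y hy) hls hyt hxy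
    have hgxy := hmono (hV x hx) (hV y hy) hxy
    have e1 : (g y - g x) * η * ((t - s) / 2 * (s - l)) ≤
        (g y - g x) * (g s - g l) * ((y - s) * (x - l)) := by
      have : 0 ≤ g y - g x := by linarith
      have : 0 ≤ s - l := by linarith
      have : 0 ≤ (t - s) / 2 := by linarith
      have : (t - s) / 2 ≤ y - s := by linarith
      have : s - l ≤ x - l := by linarith
      gcongr
      · nlinarith
      · linarith
    have e2 : (y - x) * (s - l) * ((g y - g s) * (g x - g l)) ≤ (y - x) * (s - l) * 1 := by
      have : 0 ≤ (y - x) * (s - l) := mul_nonneg (by linarith) (by linarith)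
      gcongr
    have e3 : (s - l) * ((g y - g x) * (η * (t - s))) < (s - l) * (2 * (y - x)) := by linarith
    exact (lt_of_mul_lt_mul_left e3 (by linarith)).le
  have main : ∀ x ∈ Icc s t, ∀ y ∈ Icc s t, x < y →
      (g y - g x) * (η * (t - s)) ≤ 2 * (y - x) := by
    intro x hx y hy hxy
    have hm : (s + t) / 2 ∈ Icc s t := ⟨by linarith, by linarith⟩
    rcases le_or_gt y ((s + t) / 2) with h | h
    · exact left x hx y hy hxy h
    rcases le_or_gt ((s + t) / 2) x with h' | h'
    · exact right x hx y hy hxy h'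
    have a1 := left x hx _ hm h' le_rfl
    have a2 := right _ hm y hy h le_rfl
    linarith
  intro x hx y hy
  rcases lt_trichotomy x y with h | rfl | h
  · have := main x hx y hy h
    rwa [abs_sub_comm, abs_sub_comm x, abs_of_pos (sub_pos.2 h),
      abs_of_pos (sub_pos.2 (hmono (hV x hx) (hV y hy) h))]
  · simp
  · have := main y hy x hx h
    rwa [abs_of_pos (sub_pos.2 h), abs_of_pos (sub_pos.2 (hmono (hV y hy) (hV x hx) h))]

theorem exists_Icc_lipschitz (hg : ExpandsCrossRatio g V) (hoc : V.OrdConnected)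
    (hdiam : ∀ x ∈ V, ∀ y ∈ V, g x - g y ≤ 1) {l s t r η : ℝ} (hη : 0 < η)
    (hl : l ∈ g '' V) (hs : s ∈ g '' V) (ht : t ∈ g '' V) (hr : r ∈ g '' V)
    (hls : η ≤ s - l) (hst : s < t) (htr : η ≤ r - t) :
    ∃ s' ∈ V, ∃ t' ∈ V, s' < t' ∧ g '' Icc s' t' = Icc s t ∧
      (∀ x ∈ V, g x ∈ Icc s t → x ∈ Icc s' t') ∧
      ∀ x ∈ Icc s' t', ∀ y ∈ Icc s' t', |g x - g y| * (η * (t' - s')) ≤ 2 * |x - y| := by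
  wlog hmono : StrictMonoOn g V generalizing g l s t r
  · have h1 := hg.mono_or_anti.resolve_left hmono
    have hneg : ∀ c, c ∈ g '' V → -c ∈ (fun x => -g x) '' V := by
      rintro _ ⟨x, hx, rfl⟩
      exact ⟨x, hx, rfl⟩
    obtain ⟨s', hs', t', ht', hlt, him, hmem, hlip⟩ := this hg.neg
      (fun x hx y hy => by linarith [hdiam y hy x hx]) (hneg r hr) (hneg t ht) (hneg s hs)
      (hneg l hl) (by linarith) (by linarith) (by linarith) h1.neg
    refine ⟨s', hs', t', ht', hlt, ?_, fun x hx hgx => hmem x hx ?_, fun x hx y hy => ?_⟩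
    · ext c
      have := Set.ext_iff.1 him (-c)
      simp only [mem_image, neg_inj, mem_Icc, neg_le_neg_iff] at this
      simp only [mem_image, mem_Icc]
      rw [this, and_comm]
    · exact ⟨neg_le_neg hgx.2, neg_le_neg hgx.1⟩
    · have := hlip x hx y hy
      rwa [← abs_neg, show -(-g x - -g y) = g x - g y by ring] at this
  obtain ⟨l', hl', rfl⟩ := hl
  obtain ⟨s', hs', rfl⟩ := hs
  obtain ⟨t', ht', rfl⟩ := ht
  obtain ⟨r', hr', rfl⟩ := hr
  have e1 : l' < s' := (hmono.lt_iff_lt hl' hs').1 (by linarith)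
  have e2 : s' < t' := (hmono.lt_iff_lt hs' ht').1 (by linarith)
  have e3 : t' < r' := (hmono.lt_iff_lt ht' hr').1 (by linarith)
  have hsub : Icc s' t' ⊆ V := hoc.out hs' ht'
  refine ⟨s', hs', t', ht', e2, Subset.antisymm ?_ ?_, ?_, ?_⟩
  · rintro _ ⟨x, hx, rfl⟩
    exact ⟨hmono.monotoneOn hs' (hsub hx) hx.1, hmono.monotoneOn (hsub hx) ht' hx.2⟩
  · exact intermediate_value_Icc e2.le (hg.continuousOn.mono hsub)
  · exact fun x hx hgx => ⟨(hmono.le_iff_le hs' hx).1 hgx.1, (hmono.le_iff_le hx ht').1 hgx.2⟩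
  · exact hg.abs_sub_mul_le hoc hmono hdiam hl' hr' e1 e2 e3 hη hls htr

end ExpandsCrossRatio

/-! ### Wandering intervals and the interior of the stable domain. -/

theorem not_mem_iterDom_of_le {x : ℝ} {m n : ℕ} (hmn : m ≤ n) (h : x ∉ iterDom f C m) :
    x ∉ iterDom f C n := fun hx => h fun k hk => hx k (hk.trans_le hmn)

theorem exists_not_mem_iterDom {x : ℝ} (h : x ∉ stableDom f C) : ∃ n, x ∉ iterDom f C n := by
  by_contra! hcon
  exact h fun k => hcon (k + 1) k (by omega)

/-- The diameters of the images of a wandering interval tend to zero. -/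
theorem tendsto_volume_image_of_wandering (hf : IsPiecewiseNegSchwarzian f C) {x s t : ℝ}
    (hx : x ∈ Icc s t) (hst : Icc s t ⊆ stableDom f C)
    (hw : ∀ m n, m < n → ¬ uIcc (f^[m] x) (f^[n] x) ⊆ stableDom f C) :
    Tendsto (fun n => volume (f^[n] '' Icc s t)) atTop (𝓝 0) := by
  have hc : ∀ n, ContinuousOn f^[n] (Icc s t) := fun n =>
    (continuousOn_iterate hf).mono (hst.trans (stableDom_subset_iterDom n))
  -- By `hw` the iterates of `x` lie in distinct components of `stableDom`. The images are then
  -- disjoint subsets of (0,1), so their measures are summable.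
  have hdisj : ∀ m n, m < n → Disjoint (f^[m] '' Icc s t) (f^[n] '' Icc s t) := by
    intro m n hmn
    rw [Set.disjoint_left]
    rintro y ⟨z, hz, rfl⟩ ⟨w, hw', hzw⟩
    have hcomp : ∀ z ∈ Icc s t, ∀ n,
        f^[n] z ∈ ordConnectedComponent (stableDom f C) (f^[n] x) := fun z hz n =>
      uIcc_iterate_subset_stableDom hf ((ordConnected_Icc.uIcc_subset hx hz).trans hst) n
    have h1 := hcomp z hz m
    have h2 := hcomp w hw' n
    rw [hzw] at h2
    exact hw m n hmn (mem_ordConnectedComponent_trans h1 (mem_ordConnectedComponent_comm.1 h2))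
  refine ENNReal.tendsto_atTop_zero_of_tsum_ne_top ?_
  rw [← measure_iUnion (fun m n hmn => (lt_or_gt_of_ne hmn).elim (hdisj m n)
    fun h => (hdisj n m h).symm) fun n => (isCompact_Icc.image_of_continuousOn (hc n)).measurableSet]
  refine ((measure_mono (iUnion_subset fun n => ?_)).trans_lt
    (measure_Ioo_lt_top (a := (0 : ℝ)) (b := 1))).ne
  rintro _ ⟨z, hz, rfl⟩
  exact (hst hz n).1

theorem abs_iterate_sub_le_volume (hf : IsPiecewiseNegSchwarzian f C) {s t x y : ℝ}
    (hst : Icc s t ⊆ stableDom f C) (hx : x ∈ Icc s t) (hy : y ∈ Icc s t) (n : ℕ) :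
    ENNReal.ofReal |f^[n] x - f^[n] y| ≤ volume (f^[n] '' Icc s t) := by
  have hsub := ordConnected_Icc.uIcc_subset hx hy
  rw [abs_sub_comm, ← Real.volume_interval]
  exact measure_mono ((uIcc_iterate_subset hf (hsub.trans hst) n).trans (image_mono hsub))

/-- Wandering intervals do not accumulate on an interval that avoids the orbits of the lateral
exceptional values. -/
theorem not_wandering (hf : IsPiecewiseNegSchwarzian f C) {a b : ℝ}
    (hdisj : Ioo a b ∩ exceptionalValueOrbits f C = ∅) {x s t : ℝ} (hst : s < t)
    (hx : x ∈ Icc s t) (hsub : Icc s t ⊆ stableDom f C)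
    (hw : ∀ m n, m < n → ¬ uIcc (f^[m] x) (f^[n] x) ⊆ stableDom f C) :
    omegaSet f C x ∩ Ioo a b = ∅ := by
  rw [← not_nonempty_iff_eq_empty]
  rintro ⟨p, hp, hpI⟩
  have hxQ := hsub hx
  have hw' : ∀ m n, m ≠ n → ¬ uIcc (f^[m] x) (f^[n] x) ⊆ stableDom f C := fun m n hmn =>
    (lt_or_gt_of_ne hmn).elim (hw m n) fun h => uIcc_comm (f^[n] x) _ ▸ hw n m h
  have hne : ∀ m n, m ≠ n → f^[m] x ≠ f^[n] x := fun m n hmn h => hw' m n hmn (by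
    rw [h, uIcc_self]
    exact singleton_subset_iff.2 (iterate_mem_stableDom hxQ n))
  -- The middle one of three distinct orbit points has unstable points on both sides, strictly
  -- inside (0,1), as `exists_Ioo_subset_image` requires.
  obtain ⟨i, j, k, hij, hjk⟩ : ∃ i j k, f^[i] x < f^[j] x ∧ f^[j] x < f^[k] x := by
    rcases lt_or_gt_of_ne (hne 0 1 (by norm_num)) with h1 | h1 <;>
    rcases lt_or_gt_of_ne (hne 1 2 (by norm_num)) with h2 | h2 <;>
    rcases lt_or_gt_of_ne (hne 0 2 (by norm_num)) with h3 | h3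
    exacts [⟨0, 1, 2, h1, h2⟩, ⟨0, 1, 2, h1, h2⟩, ⟨0, 2, 1, h3, h2⟩, ⟨2, 0, 1, h3, h1⟩,
      ⟨1, 0, 2, h1, h3⟩, ⟨1, 2, 0, h2, h3⟩, ⟨2, 1, 0, h2, h1⟩, ⟨2, 1, 0, h2, h1⟩]
  have hji : j ≠ i := by rintro rfl; exact lt_irrefl _ hij
  have hjk' : j ≠ k := by rintro rfl; exact lt_irrefl _ hjk
  obtain ⟨u, huI, huQ⟩ := not_subset.1 (hw' i j hji.symm)
  obtain ⟨v, hvI, hvQ⟩ := not_subset.1 (hw' j k hjk')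
  rw [uIcc_of_le hij.le] at huI
  rw [uIcc_of_le hjk.le] at hvI
  have hXQ := iterate_mem_stableDom hxQ j
  have huX : u < f^[j] x := lt_of_le_of_ne huI.2 (by rintro rfl; exact huQ hXQ)
  have hXv : f^[j] x < v := lt_of_le_of_ne hvI.1 (by rintro rfl; exact hvQ hXQ)
  have hu0 : 0 < u := (hxQ i).1.1.trans_le huI.1
  have hv1 : v < 1 := hvI.2.trans_lt (hxQ k).1.2
  obtain ⟨n₁, hn₁⟩ := exists_not_mem_iterDom huQ
  obtain ⟨n₂, hn₂⟩ := exists_not_mem_iterDom hvQ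
  have hST : f^[j] s ≠ f^[j] t := fun h => by
    have hinj := (hf.expandsCrossRatio_iterDom (n := j + 1) ordConnected_Icc
      (hsub.trans (stableDom_subset_iterDom _)) (by omega)).injOn
    rw [Function.iterate_succ'] at hinj
    exact hst.ne (hinj.of_comp (left_mem_Icc.2 hst.le) (right_mem_Icc.2 hst.le) h)
  have hSTpos : 0 < |f^[j] s - f^[j] t| := abs_pos.2 (sub_ne_zero.2 hST)
  obtain ⟨δ, hδ, hδI⟩ := Metric.nhds_basis_closedBall.mem_iff.1 (Ioo_mem_nhds hpI.1 hpI.2)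
  rw [Real.closedBall_eq_Icc] at hδI
  -- The first bound keeps the small image within `δ / 2` of `p`; the second contradicts
  -- `sub_mul_le`.
  obtain ⟨η, hη, hη1, hη2⟩ : ∃ η > 0, η ≤ δ / 4 ∧ 8 * η < |f^[j] s - f^[j] t| * δ :=
    ⟨min (δ / 4) (|f^[j] s - f^[j] t| * δ / 16), by positivity, min_le_left _ _, by
      have := min_le_right (δ / 4) (|f^[j] s - f^[j] t| * δ / 16)
      have : 0 < |f^[j] s - f^[j] t| * δ := by positivity
      linarith⟩
  have hsmall : ∀ᶠ n in atTop, volume (f^[n + j] '' Icc s t) < ENNReal.ofReal η :=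
    ((tendsto_add_atTop_iff_nat j).2 (tendsto_volume_image_of_wandering hf hx hsub hw)).eventually
      (gt_mem_nhds (by simpa using hη))
  have hpj : p ∈ omegaSet f C (f^[j] x) := by rwa [omegaSet_iterate hxQ j]
  have hfreq := frequently_of_mem_omegaSet hpj
    (Metric.closedBall_mem_nhds p (ε := δ / 4) (by positivity))
  obtain ⟨n, hnp, hns, hn1⟩ := (hfreq.and_eventually
    (hsmall.and (eventually_ge_atTop (n₁ + n₂ + 1)))).exists
  rw [Metric.mem_closedBall, Real.dist_eq] at hnp
  have hclose : ∀ z ∈ Icc s t, ∀ w ∈ Icc s t, |f^[n] (f^[j] z) - f^[n] (f^[j] w)| < η := by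
    intro z hz w hw
    have := (abs_iterate_sub_le_volume hf hsub hz hw (n + j)).trans_lt hns
    rw [ENNReal.ofReal_lt_ofReal_iff hη] at this
    rwa [Function.iterate_add_apply, Function.iterate_add_apply] at this
  have hXI : f^[n] (f^[j] x) ∈ Ioo a b := hδI (by
    rw [abs_le] at hnp
    exact ⟨by linarith, by linarith⟩)
  obtain ⟨u', v', -, hu'x, hxv', -, hV, hu', hv', him⟩ := hf.exists_Ioo_subset_image hdisj
    (by omega : n ≠ 0) (stableDom_subset_iterDom n hXQ) hXI
    (not_mem_iterDom_of_le (by omega) hn₁) (not_mem_iterDom_of_le (by omega) hn₂)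
    hu0 huX hXv hv1
  have hn0 : n ≠ 0 := by omega
  -- The interval from `f^j(x)` to `f^j(z)` is stable, so it cannot cross `u'` or `v'`, where `f^n`
  -- is not defined.
  have hmemV : ∀ z ∈ Icc s t, f^[j] z ∈ Ioo u' v' := by
    intro z hz
    have h1 : uIcc (f^[j] x) (f^[j] z) ⊆ iterDom f C n :=
      (uIcc_iterate_subset_stableDom hf ((ordConnected_Icc.uIcc_subset hx hz).trans hsub) j).trans
        (stableDom_subset_iterDom n)
    constructor
    · by_contra! hc
      exact hu' (h1 (mem_uIcc.2 (Or.inr ⟨hc, hu'x.le⟩)))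
    · by_contra! hc
      exact hv' (h1 (mem_uIcc.2 (Or.inl ⟨hxv'.le, hc⟩)))
  have hV01 : Ioo u' v' ⊆ Ioo 0 1 := fun y hy => (hV hy 0 (by omega)).1
  have hg := hf.expandsCrossRatio_iterDom ordConnected_Ioo hV hn0
  have hs' : s ∈ Icc s t := left_mem_Icc.2 hst.le
  have ht' : t ∈ Icc s t := right_mem_Icc.2 hst.le
  have hnear : ∀ z ∈ Icc s t, |f^[n] (f^[j] z) - p| ≤ δ / 2 := by
    intro z hz
    have h1 := hclose z hz x hx
    have h2 := abs_sub_le (f^[n] (f^[j] z)) (f^[n] (f^[j] x)) p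
    linarith
  have hl := him (hδI ⟨le_rfl, by linarith⟩ : p - δ ∈ Ioo a b)
  have hr := him (hδI ⟨by linarith, le_rfl⟩ : p + δ ∈ Ioo a b)
  have hfinal : ∀ z ∈ Icc s t, ∀ w ∈ Icc s t, f^[j] z < f^[j] w →
      (f^[j] w - f^[j] z) * δ ≤ 8 * η := fun z hz w hw h =>
    (hg.sub_mul_le hV01 hδ hl hr (hmemV z hz) (hmemV w hw) h (hnear z hz) (hnear w hw)).trans
      (by linarith [hclose w hw z hz])
  rcases lt_or_gt_of_ne hST with h | h
  · have := hfinal s hs' t ht' h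
    rw [abs_of_neg (sub_neg.2 h)] at hη2
    linarith
  · have := hfinal t ht' s hs' h
    rw [abs_of_pos (sub_pos.2 h)] at hη2
    linarith

/-- Almost every interior point of the stable domain whose orbit accumulates on `(a, b)` is in the
basin of a periodic-like attractor. -/
theorem volume_interior_stableDom_eq_zero (hf : IsPiecewiseNegSchwarzian f C) {a b : ℝ}
    (hdisj : Ioo a b ∩ exceptionalValueOrbits f C = ∅) :
    volume {x ∈ interior (stableDom f C) | x ∉ periodicLikeBasin f C ∧
      (omegaSet f C x ∩ Ioo a b).Nonempty} = 0 := by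
  refine measure_mono_null ?_ (volume_preperiodic_eq_zero hf)
  rintro x ⟨hxi, hxB, hxo⟩
  have hxQ := interior_subset hxi
  refine ⟨hxQ, ?_⟩
  obtain ⟨ε, hε, hsub⟩ := Metric.nhds_basis_closedBall.mem_iff.1 (mem_interior_iff_mem_nhds.1 hxi)
  rw [Real.closedBall_eq_Icc] at hsub
  by_cases hw : ∀ m n, m < n → ¬ uIcc (f^[m] x) (f^[n] x) ⊆ stableDom f C
  · have := not_wandering hf hdisj (by linarith) (⟨by linarith, by linarith⟩) hsub hw
    exact absurd this hxo.ne_empty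
  · push Not at hw
    obtain ⟨m, n, hmn, h⟩ := hw
    refine ⟨m, 2 * (n - m), by omega, ?_⟩
    by_contra hne
    have hn : f^[n] x = f^[n - m] (f^[m] x) := by
      rw [← Function.iterate_add_apply]
      congr 2
      omega
    rw [hn] at h
    exact hxB ((mem_periodicLikeBasin_iterate hxQ m).1
      (mem_periodicLikeBasin_of_uIcc_subset hf (by omega) h hne))

/-! ### Density points and the zero-one law. -/

/-- Applied to the complement of the interior of `stableDom`: off a countable set, its points have
no stable interval adjacent on either side. -/
theorem countable_one_sided_isolated (s : Set ℝ) :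
    {x ∈ s | (∃ y < x, s ∩ Ioo y x = ∅) ∨ ∃ y > x, s ∩ Ioo x y = ∅}.Countable := by
  refine ((countable_setOfPred_isolated_left_within (s := s)).union
    (countable_setOfPred_isolated_right_within (s := s))).mono ?_
  rintro x ⟨hx, ⟨y, hy, h⟩ | ⟨y, hy, h⟩⟩
  · refine Or.inl ⟨hx, empty_mem_iff_bot.1 (mem_nhdsWithin.2 ⟨Ioi y, isOpen_Ioi, hy, ?_⟩)⟩
    rintro z ⟨hz, hzs, hzx⟩
    exact h.subset ⟨hzs, hz, hzx⟩
  · refine Or.inr ⟨hx, empty_mem_iff_bot.1 (mem_nhdsWithin.2 ⟨Iio y, isOpen_Iio, hy, ?_⟩)⟩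
    rintro z ⟨hz, hzs, hzx⟩
    exact h.subset ⟨hzs, hzx, hz⟩

/-- Lebesgue measure is one-dimensional Hausdorff measure, so the Lipschitz bound needs no
measurability of `S`. -/
theorem volume_image_le_of_abs_sub_mul_le {g : ℝ → ℝ} {S : Set ℝ} {c : ℝ} (hc : 0 < c)
    (h : ∀ x ∈ S, ∀ y ∈ S, |g x - g y| * c ≤ 2 * |x - y|) :
    volume (g '' S) ≤ ENNReal.ofReal (2 / c) * volume S := by
  have hl : LipschitzOnWith (Real.toNNReal (2 / c)) g S := by
    refine LipschitzOnWith.of_dist_le_mul fun x hx y hy => ?_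
    rw [Real.dist_eq, Real.dist_eq, Real.coe_toNNReal _ (by positivity), div_mul_eq_mul_div,
      le_div_iff₀ hc]
    exact h x hx y hy
  have := hl.hausdorffMeasure_image_le (d := 1) zero_le_one
  rwa [hausdorffMeasure_real, ENNReal.rpow_one] at this

/-- If `(s_j, t_j)` shrink to a density point of `G`, and the relative measure of the complement
of `G` in them bounds a constant, then that constant is zero. -/
theorem eq_zero_of_density {G : Set ℝ} (hG : MeasurableSet G) {x : ℝ}
    (hx : ∀ (w δ : ℕ → ℝ), Tendsto δ atTop (𝓝[>] 0) →
      (∀ᶠ j in atTop, x ∈ Metric.closedBall (w j) (1 * δ j)) →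
      Tendsto (fun j => volume (G ∩ Metric.closedBall (w j) (δ j)) /
        volume (Metric.closedBall (w j) (δ j))) atTop (𝓝 1))
    {c : ENNReal} {K : ℝ}
    (h : ∀ ε > 0, ∃ s t, s < t ∧ t - s < ε ∧ x ∈ Icc s t ∧
      c ≤ ENNReal.ofReal (K / (t - s)) * volume (Icc s t \ G)) : c = 0 := by
  choose s t hst hlt hxm hc using fun j : ℕ =>
    h (1 / ((j : ℝ) + 1)) (by positivity)
  have hball : ∀ j, Metric.closedBall ((s j + t j) / 2) ((t j - s j) / 2) = Icc (s j) (t j) := by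
    intro j
    rw [Real.closedBall_eq_Icc]
    congr 1 <;> ring
  have hδ : Tendsto (fun j => (t j - s j) / 2) atTop (𝓝[>] 0) := by
    refine tendsto_nhdsWithin_iff.2 ⟨?_, Eventually.of_forall fun j => ?_⟩
    · refine squeeze_zero (fun j => by linarith [hst j]) (fun j => ?_)
        tendsto_one_div_add_atTop_nhds_zero_nat
      linarith [hlt j, hst j]
    · exact half_pos (sub_pos.2 (hst j))
  have hlim := hx (fun j => (s j + t j) / 2) (fun j => (t j - s j) / 2) hδ
    (Eventually.of_forall fun j => by rw [one_mul, hball]; exact hxm j)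
  simp only [hball] at hlim
  have hvol : ∀ j, volume (Icc (s j) (t j)) = ENNReal.ofReal (t j - s j) := fun j =>
    Real.volume_Icc
  have hvol0 : ∀ j, volume (Icc (s j) (t j)) ≠ 0 := fun j => by
    rw [hvol]; simpa using hst j
  have hvolt : ∀ j, volume (Icc (s j) (t j)) ≠ ⊤ := fun j => by
    rw [hvol]; exact ENNReal.ofReal_ne_top
  -- The factor `1 / (t - s)` turns the measure of the complement into a relative measure, which
  -- tends to 0 at a density point.
  have hle : ∀ j, c ≤ ENNReal.ofReal K *
      (1 - volume (G ∩ Icc (s j) (t j)) / volume (Icc (s j) (t j))) := by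
    intro j
    refine (hc j).trans_eq ?_
    have h1 : volume (Icc (s j) (t j) \ G) =
        volume (Icc (s j) (t j)) - volume (G ∩ Icc (s j) (t j)) := by
      rw [← sdiff_inter_self_eq_sdiff, measure_sdiff inter_subset_right
        (hG.inter measurableSet_Icc).nullMeasurableSet
        (measure_ne_top_of_subset inter_subset_right (hvolt j))]
    rw [← ENNReal.div_self (hvol0 j) (hvolt j), ← ENNReal.sub_div fun _ _ => hvol0 j, ← h1,
      ENNReal.ofReal_div_of_pos (sub_pos.2 (hst j)), ← hvol j, ENNReal.div_eq_inv_mul,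
      ENNReal.div_eq_inv_mul]
    ring
  have hlim2 : Tendsto (fun j => ENNReal.ofReal K *
      (1 - volume (G ∩ Icc (s j) (t j)) / volume (Icc (s j) (t j)))) atTop (𝓝 0) := by
    have := ENNReal.Tendsto.const_mul (a := ENNReal.ofReal K)
      (ENNReal.Tendsto.sub (tendsto_const_nhds (x := (1 : ENNReal))) hlim (Or.inl (by simp)))
      (Or.inr ENNReal.ofReal_ne_top)
    simpa using this
  exact le_antisymm (ge_of_tendsto' hlim2 hle) bot_le

/-- Near a point that is not in the closure of a component of the interior of the stable domain,
small intervals are mapped with bounded distortion over compact subintervals of `(a, b)`. -/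
theorem exists_small_Icc (hf : IsPiecewiseNegSchwarzian f C) {a b : ℝ}
    (hdisj : Ioo a b ∩ exceptionalValueOrbits f C = ∅) {x : ℝ} (hxQ : x ∈ stableDom f C)
    (hleft : ∀ y < x, ¬ Ioo y x ⊆ stableDom f C) (hright : ∀ y > x, ¬ Ioo x y ⊆ stableDom f C)
    {s t η : ℝ} (hη : 0 < η) (has : a + η < s) (hst : s < t) (htb : t + η < b)
    (hfreq : ∃ᶠ n in atTop, f^[n] x ∈ Icc s t) {ε : ℝ} (hε : 0 < ε) :
    ∃ n s' t', s' < t' ∧ t' - s' < ε ∧ x ∈ Icc s' t' ∧ f^[n] '' Icc s' t' = Icc s t ∧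
      ∀ x ∈ Icc s' t', ∀ y ∈ Icc s' t', |f^[n] x - f^[n] y| * (η * (t' - s')) ≤ 2 * |x - y| := by
  have hx0 := (hxQ 0).1
  -- Unstable points within `ε / 2` of `x` on both sides confine the branch to length less than `ε`;
  -- `max 0` and `min 1` keep them inside (0,1).
  obtain ⟨u, ⟨hul, hux⟩, huQ⟩ := not_subset.1
    (hleft (max 0 (x - ε / 2)) (max_lt hx0.1 (by linarith)))
  obtain ⟨v, ⟨hxv, hvr⟩, hvQ⟩ := not_subset.1
    (hright (min 1 (x + ε / 2)) (lt_min hx0.2 (by linarith)))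
  rw [max_lt_iff] at hul
  rw [lt_min_iff] at hvr
  obtain ⟨n₁, hn₁⟩ := exists_not_mem_iterDom huQ
  obtain ⟨n₂, hn₂⟩ := exists_not_mem_iterDom hvQ
  obtain ⟨n, hnst, hn⟩ := (hfreq.and_eventually (eventually_ge_atTop (n₁ + n₂ + 1))).exists
  obtain ⟨u', v', huu', hu'x, hxv', hv'v, hV, -, -, him⟩ := hf.exists_Ioo_subset_image hdisj
    (by omega : n ≠ 0) (stableDom_subset_iterDom n hxQ)
    (⟨by linarith [hnst.1], by linarith [hnst.2]⟩)
    (not_mem_iterDom_of_le (by omega) hn₁) (not_mem_iterDom_of_le (by omega) hn₂)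
    hul.1 hux hxv hvr.1
  have hg := hf.expandsCrossRatio_iterDom ordConnected_Ioo hV (by omega)
  have hrange : ∀ y ∈ Ioo u' v', f^[n] y ∈ Ioo (0 : ℝ) 1 := by
    intro y hy
    obtain ⟨m, rfl⟩ := Nat.exists_eq_succ_of_ne_zero (by omega : n ≠ 0)
    rw [Function.iterate_succ_apply']
    exact hf.mapsTo_Ioo (hV hy m (by omega))
  obtain ⟨s', hs', t', ht', hlt, himg, hmem, hlip⟩ := hg.exists_Icc_lipschitz ordConnected_Ioo
    (fun y hy z hz => by linarith [(hrange y hy).2, (hrange z hz).1]) hη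
    (him (⟨by linarith, by linarith⟩ : s - η ∈ Ioo a b))
    (him (⟨by linarith, by linarith⟩ : s ∈ Ioo a b))
    (him (⟨by linarith, by linarith⟩ : t ∈ Ioo a b))
    (him (⟨by linarith, by linarith⟩ : t + η ∈ Ioo a b)) (by linarith) hst (by linarith)
  exact ⟨n, s', t', hlt, by linarith [hs'.1, ht'.2], hmem x ⟨hu'x, hxv'⟩ hnst, himg, hlip⟩

/-- The points of `(a, b)` whose orbit is infinite, accumulates on `(a, b)`, and which are not in
the interior of the stable domain. -/
def recurrentSet (f : ℝ → ℝ) (C : Set ℝ) (a b : ℝ) : Set ℝ :=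
  {x ∈ Ioo a b | x ∈ stableDom f C ∧ x ∉ interior (stableDom f C) ∧
    (omegaSet f C x ∩ Ioo a b).Nonempty}

/-- A set of recurrent points that is invariant under returns to `(a, b)` is null or has full
measure. -/
theorem volume_diff_eq_zero_of_invariant (hf : IsPiecewiseNegSchwarzian f C) {a b : ℝ}
    (hdisj : Ioo a b ∩ exceptionalValueOrbits f C = ∅) {G : Set ℝ} (hGm : MeasurableSet G)
    (hG : G ⊆ recurrentSet f C a b)
    (hinv : ∀ x ∈ G, ∀ n, f^[n] x ∈ Ioo a b → f^[n] x ∈ G) (hG0 : volume G ≠ 0) :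
    volume (Ioo a b \ G) = 0 := by
  have hN := countable_one_sided_isolated (interior (stableDom f C))ᶜ
  have hdens := IsUnifLocDoublingMeasure.ae_tendsto_measure_inter_div (volume : Measure ℝ) G 1
  have : (ae (volume.restrict G)).NeBot := by
    rw [ae_neBot]
    simpa using hG0
  obtain ⟨x, hx, hxG, hxN⟩ := (hdens.and ((ae_restrict_mem hGm).and
    (ae_restrict_of_ae (hN.ae_notMem volume)))).exists
  obtain ⟨hxI, hxQ, hxi, p, hp, hpI⟩ := hG hxG
  have hleft : ∀ y < x, ¬ Ioo y x ⊆ stableDom f C := fun y hy hsub =>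
    hxN ⟨hxi, Or.inl ⟨y, hy, eq_empty_of_forall_notMem fun z hz =>
      hz.1 (interior_maximal hsub isOpen_Ioo hz.2)⟩⟩
  have hright : ∀ y > x, ¬ Ioo x y ⊆ stableDom f C := fun y hy hsub =>
    hxN ⟨hxi, Or.inr ⟨y, hy, eq_empty_of_forall_notMem fun z hz =>
      hz.1 (interior_maximal hsub isOpen_Ioo hz.2)⟩⟩
  -- By invariance, `Icc s t \ G` is covered by the image under `f^n` of `Icc s' t' \ G`, whose
  -- relative measure tends to 0 as `[s', t']` shrinks to the density point `x`.
  have key : ∀ s t, a < s → s < p → p < t → t < b → volume (Icc s t \ G) = 0 := by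
    intro s t has hsp hpt htb
    have hfreq := frequently_of_mem_omegaSet hp (Icc_mem_nhds hsp hpt)
    obtain ⟨η, hη, h1, h2⟩ : ∃ η > 0, a + η < s ∧ t + η < b :=
      ⟨min (s - a) (b - t) / 2, half_pos (lt_min (by linarith) (by linarith)),
        by linarith [min_le_left (s - a) (b - t), min_le_right (s - a) (b - t)],
        by linarith [min_le_left (s - a) (b - t), min_le_right (s - a) (b - t)]⟩
    refine eq_zero_of_density hGm (fun w δ hδ hw => hx w δ hδ hw) (K := 2 / η) fun ε hε => ?_
    obtain ⟨n, s', t', hlt, hltε, hxm, himg, hlip⟩ := exists_small_Icc hf hdisj hxQ hleft hright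
      hη h1 (hsp.trans hpt) h2 hfreq hε
    refine ⟨s', t', hlt, hltε, hxm, ?_⟩
    have hle := volume_image_le_of_abs_sub_mul_le (S := Icc s' t' \ G)
      (mul_pos hη (sub_pos.2 hlt)) fun y hy z hz => hlip y hy.1 z hz.1
    rw [← div_div] at hle
    refine (measure_mono ?_).trans hle
    rintro w ⟨hw, hwG⟩
    rw [← himg] at hw
    obtain ⟨z, hz, rfl⟩ := hw
    refine mem_image_of_mem _ ⟨hz, fun hzG => hwG (hinv z hzG n ?_)⟩
    have := himg.subset (mem_image_of_mem _ hz)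
    exact ⟨has.trans_le this.1, this.2.trans_lt htb⟩
  have hcover : Ioo a b \ G ⊆ ⋃ (s : ℚ) (t : ℚ),
      {w | a < s ∧ (s : ℝ) < p ∧ p < t ∧ (t : ℝ) < b ∧ w ∈ Icc (s : ℝ) t \ G} := by
    rintro w ⟨hw, hwG⟩
    obtain ⟨s, hs1, hs2⟩ := exists_rat_btwn (lt_min hw.1 hpI.1)
    obtain ⟨t, ht1, ht2⟩ := exists_rat_btwn (max_lt hw.2 hpI.2)
    rw [lt_min_iff] at hs2
    rw [max_lt_iff] at ht1
    exact mem_iUnion₂.2 ⟨s, t, hs1, hs2.2, ht1.2, ht2, ⟨hs2.1.le, ht1.1.le⟩, hwG⟩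
  refine measure_mono_null hcover (measure_iUnion_null fun s => measure_iUnion_null fun t => ?_)
  by_cases h : a < s ∧ (s : ℝ) < p ∧ p < t ∧ (t : ℝ) < b
  · refine measure_mono_null ?_ (key s t h.1 h.2.1 h.2.2.1 h.2.2.2)
    rintro w ⟨-, -, -, -, hw⟩
    exact hw
  · convert measure_empty (μ := (volume : Measure ℝ))
    refine eq_empty_of_forall_notMem ?_
    rintro w ⟨h1, h2, h3, h4, -⟩
    exact h ⟨h1, h2, h3, h4⟩

/-! ### Measurability, return-invariance and visits to subintervals. -/

theorem measurableSet_iterDom_inter_preimage (hf : IsPiecewiseNegSchwarzian f C) (n : ℕ)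
    {S : Set ℝ} (hS : MeasurableSet S) : MeasurableSet (iterDom f C n ∩ f^[n] ⁻¹' S) := by
  have h1 := (continuousOn_iterate hf (n := n)).domRestrict.measurable hS
  have h2 := (hf.isOpen_iterDom n).measurableSet.subtype_image h1
  convert h2 using 1
  ext x
  constructor
  · exact fun h => ⟨⟨x, h.1⟩, h.2, rfl⟩
  · rintro ⟨⟨y, hy⟩, hyS, rfl⟩
    exact ⟨hy, hyS⟩

theorem measurableSet_stableDom (hf : IsPiecewiseNegSchwarzian f C) :
    MeasurableSet (stableDom f C) := by
  have : stableDom f C = ⋂ n, iterDom f C n := by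
    refine Subset.antisymm (subset_iInter stableDom_subset_iterDom) fun x hx => ?_
    by_contra h
    obtain ⟨n, hn⟩ := exists_not_mem_iterDom h
    exact hn (mem_iInter.1 hx n)
  rw [this]
  exact MeasurableSet.iInter fun n => (hf.isOpen_iterDom n).measurableSet

/-- Compactness of `[s, t]` replaces an accumulation point by infinitely many visits, a condition
built from countable operations. -/
theorem omegaSet_inter_Ioo_nonempty_iff {a b x : ℝ} (hx : x ∈ stableDom f C) :
    (omegaSet f C x ∩ Ioo a b).Nonempty ↔
      ∃ s t : ℚ, a < s ∧ (t : ℝ) < b ∧ ∃ᶠ n in atTop, f^[n] x ∈ Icc (s : ℝ) t := by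
  constructor
  · rintro ⟨p, hp, hpI⟩
    obtain ⟨s, hs1, hs2⟩ := exists_rat_btwn hpI.1
    obtain ⟨t, ht1, ht2⟩ := exists_rat_btwn hpI.2
    exact ⟨s, t, hs1, ht2, frequently_of_mem_omegaSet hp (Icc_mem_nhds hs2 ht1)⟩
  · rintro ⟨s, t, hs, ht, h⟩
    obtain ⟨p, hp, hcl⟩ :=
      (isCompact_Icc (a := (s : ℝ)) (b := t)).exists_mapClusterPt_of_frequently h
    exact ⟨p, (mem_omegaSet_iff hx).2 (mapClusterPt_iff_frequently.1 hcl),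
      hs.trans_le hp.1, hp.2.trans_lt ht⟩

theorem measurableSet_recurrentSet (hf : IsPiecewiseNegSchwarzian f C) (a b : ℝ) :
    MeasurableSet (recurrentSet f C a b) := by
  have : recurrentSet f C a b = Ioo a b ∩ (stableDom f C ∩ ((interior (stableDom f C))ᶜ ∩
      ⋃ (s : ℚ) (t : ℚ) (_ : a < s) (_ : (t : ℝ) < b), ⋂ (N : ℕ), ⋃ (n : ℕ) (_ : N ≤ n),
        (iterDom f C n ∩ f^[n] ⁻¹' Icc (s : ℝ) t))) := by
    ext x
    refine and_congr_right fun _ => and_congr_right fun hx => and_congr_right fun _ => ?_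
    rw [omegaSet_inter_Ioo_nonempty_iff hx]
    simp only [mem_iUnion, mem_iInter, exists_prop, mem_inter_iff, mem_preimage,
      frequently_atTop, stableDom_subset_iterDom _ hx, true_and]
  rw [this]
  refine measurableSet_Ioo.inter ((measurableSet_stableDom hf).inter
    (isOpen_interior.measurableSet.compl.inter ?_))
  exact MeasurableSet.iUnion fun s => MeasurableSet.iUnion fun t => MeasurableSet.iUnion fun _ =>
    MeasurableSet.iUnion fun _ => MeasurableSet.iInter fun N => MeasurableSet.iUnion fun n =>
      MeasurableSet.iUnion fun _ => measurableSet_iterDom_inter_preimage hf n measurableSet_Icc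

/-- The point at issue is non-interiority: if an iterate were interior to the stable domain,
continuity of `f^n` would make `x` interior too. -/
theorem iterate_mem_recurrentSet (hf : IsPiecewiseNegSchwarzian f C) {a b x : ℝ}
    (hx : x ∈ recurrentSet f C a b) {n : ℕ} (hn : f^[n] x ∈ Ioo a b) :
    f^[n] x ∈ recurrentSet f C a b := by
  obtain ⟨-, hxQ, hxi, hxo⟩ := hx
  refine ⟨hn, iterate_mem_stableDom hxQ n, fun hi => hxi ?_, by rwa [omegaSet_iterate hxQ n]⟩
  have hO := (hf.isOpen_iterDom n).mem_nhds (stableDom_subset_iterDom n hxQ)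
  have hc : ContinuousAt f^[n] x := (continuousOn_iterate hf).continuousAt hO
  rw [mem_interior_iff_mem_nhds] at hi ⊢
  filter_upwards [hO, hc hi] with y hy hy' k
  rcases lt_or_ge k n with h | h
  · exact hy k h
  · have := hy' (k - n)
    rwa [← Function.iterate_add_apply, Nat.sub_add_cancel h] at this

theorem mem_stableDom_of_omegaSet_nonempty (hf : IsPiecewiseNegSchwarzian f C) {x y : ℝ}
    (hx : x ∈ Ioo (0 : ℝ) 1) (hy : y ∈ omegaSet f C x) : x ∈ stableDom f C := by
  intro n
  induction n with
  | zero => exact ⟨hx, hy.1 0⟩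
  | succ n ih =>
    refine ⟨?_, hy.1 (n + 1)⟩
    rw [Function.iterate_succ_apply']
    exact hf.mapsTo_Ioo ih

/-- An orbit that visits every subinterval of `(a, b)` with rational end points accumulates at
every point of `(a, b)`. -/
theorem Ioo_subset_omegaSet_of_visits {a b x : ℝ} (hx : x ∈ stableDom f C)
    (h : ∀ s t : ℚ, (s : ℝ) < t → Ioo (s : ℝ) t ⊆ Ioo a b → ∃ n, f^[n] x ∈ Ioo (s : ℝ) t) :
    Ioo a b ⊆ omegaSet f C x := by
  intro y hy
  rw [mem_omegaSet_iff hx]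
  intro S hS hcon
  obtain ⟨N, hN⟩ := eventually_atTop.1 hcon
  have hF : ((fun n => f^[n] x) '' Iio N).Finite := (finite_Iio N).image _
  -- Deleting the first `N` orbit points forces any visit to the remaining open set to occur at a
  -- time `≥ N`.
  have hopen : IsOpen ((Ioo a b ∩ interior S) \ ((fun n => f^[n] x) '' Iio N)) :=
    (isOpen_Ioo.inter isOpen_interior).sdiff hF.isClosed
  have hinf : (Ioo a b ∩ interior S).Infinite :=
    infinite_of_mem_nhds y (inter_mem (Ioo_mem_nhds hy.1 hy.2) (interior_mem_nhds.2 hS))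
  obtain ⟨z, hz⟩ := (hinf.sdiff hF).nonempty
  obtain ⟨l, r, hlr, hsub⟩ := mem_nhds_iff_exists_Ioo_subset.1 (hopen.mem_nhds hz)
  obtain ⟨s, hs1, hs2⟩ := exists_rat_btwn hlr.1
  obtain ⟨t, ht1, ht2⟩ := exists_rat_btwn hlr.2
  have hst : Ioo (s : ℝ) t ⊆ Ioo l r := Ioo_subset_Ioo hs1.le ht2.le
  obtain ⟨n, hn⟩ := h s t (hs2.trans ht1) fun w hw => (hsub (hst hw)).1.1
  have hn' := hsub (hst hn)
  rcases lt_or_ge n N with h' | h'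
  · exact hn'.2 (mem_image_of_mem (fun n => f^[n] x) (mem_Iio.2 h'))
  · exact hN n h' (interior_subset hn'.1.2)

/-- The recurrent points never visiting `(s, t)` are invariant under returns and miss `(s, t)`. They
cannot have full measure, so by the zero-one law they are null. -/
theorem ae_visits (hf : IsPiecewiseNegSchwarzian f C) {a b : ℝ}
    (hdisj : Ioo a b ∩ exceptionalValueOrbits f C = ∅) {s t : ℝ} (hst : s < t)
    (hsub : Ioo s t ⊆ Ioo a b) :
    ∀ᵐ x ∂volume, x ∈ recurrentSet f C a b → ∃ n, f^[n] x ∈ Ioo s t := by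
  set G := recurrentSet f C a b ∩ ⋂ n, iterDom f C n ∩ f^[n] ⁻¹' (Ioo s t)ᶜ
  have hGm : MeasurableSet G := (measurableSet_recurrentSet hf a b).inter
    (MeasurableSet.iInter fun n =>
      measurableSet_iterDom_inter_preimage hf n measurableSet_Ioo.compl)
  have hinv : ∀ x ∈ G, ∀ n, f^[n] x ∈ Ioo a b → f^[n] x ∈ G := by
    intro x hx n hn
    refine ⟨iterate_mem_recurrentSet hf hx.1 hn, mem_iInter.2 fun m =>
      ⟨stableDom_subset_iterDom m (iterate_mem_stableDom hx.1.2.1 n), ?_⟩⟩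
    have := (mem_iInter.1 hx.2 (m + n)).2
    rwa [mem_preimage, Function.iterate_add_apply] at this
  have hG0 : volume G = 0 := by
    by_contra hne
    have h1 := volume_diff_eq_zero_of_invariant hf hdisj hGm inter_subset_left hinv hne
    have h2 : Ioo s t ⊆ Ioo a b \ G := fun x hx =>
      ⟨hsub hx, fun hxG => (mem_iInter.1 hxG.2 0).2 hx⟩
    have h3 := measure_mono_null h2 h1
    rw [Real.volume_Ioo, ENNReal.ofReal_eq_zero] at h3
    linarith
  filter_upwards [measure_eq_zero_iff_ae_notMem.1 hG0] with x hx hxr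
  by_contra! hcon
  exact hx ⟨hxr, mem_iInter.2 fun n => ⟨stableDom_subset_iterDom n hxr.2.1, hcon n⟩⟩

end IntervalDynamics

theorem mainTheorem5 (f : ℝ → ℝ) (C : Set ℝ)
    (hf : IntervalDynamics.IsPiecewiseNegSchwarzian f C)
    (a b : ℝ) (hI : Ioo a b ⊆ Icc 0 1)
    (hdisj : Ioo a b ∩ IntervalDynamics.exceptionalValueOrbits f C = ∅)
    (hpos : 0 < volume (Ioo a b \ IntervalDynamics.periodicLikeBasin f C)) :
    (∀ᵐ x ∂volume, x ∈ Ioo a b \ IntervalDynamics.periodicLikeBasin f C →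
        IntervalDynamics.omegaSet f C x ∩ Ioo a b = ∅) ∨
      (∀ᵐ x ∂volume, x ∈ Ioo a b → Ioo a b ⊆ IntervalDynamics.omegaSet f C x) := by
  have hI' : Ioo a b ⊆ Ioo 0 1 :=
    (interior_maximal hI isOpen_Ioo).trans interior_Icc.subset
  -- In the positive case the zero-one law gives `recurrentSet` full measure in (a, b), so the
  -- conclusion covers almost every point of (a, b), not only those outside the periodic-like basin.
  by_cases h0 : volume (IntervalDynamics.recurrentSet f C a b) = 0
  · left
    filter_upwards [measure_eq_zero_iff_ae_notMem.1 h0, measure_eq_zero_iff_ae_notMem.1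
      (IntervalDynamics.volume_interior_stableDom_eq_zero hf hdisj)] with x hx1 hx2 hx
    rw [← not_nonempty_iff_eq_empty]
    intro hne
    obtain ⟨p, hp, -⟩ := id hne
    have hxQ := IntervalDynamics.mem_stableDom_of_omegaSet_nonempty hf (hI' hx.1) hp
    by_cases hxi : x ∈ interior (IntervalDynamics.stableDom f C)
    · exact hx2 ⟨hxi, hx.2, hne⟩
    · exact hx1 ⟨hx.1, hxQ, hxi, hne⟩
  · right
    have hfull := IntervalDynamics.volume_diff_eq_zero_of_invariant hf hdisj
      (IntervalDynamics.measurableSet_recurrentSet hf a b)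
      Subset.rfl (fun x hx n hn => IntervalDynamics.iterate_mem_recurrentSet hf hx hn) h0
    have hvis : ∀ᵐ x ∂volume, ∀ s t : ℚ, (s : ℝ) < t → Ioo (s : ℝ) t ⊆ Ioo a b →
        x ∈ IntervalDynamics.recurrentSet f C a b → ∃ n, f^[n] x ∈ Ioo (s : ℝ) t := by
      refine ae_all_iff.2 fun s => ae_all_iff.2 fun t => ?_
      by_cases hst : (s : ℝ) < t ∧ Ioo (s : ℝ) t ⊆ Ioo a b
      · filter_upwards [IntervalDynamics.ae_visits hf hdisj hst.1 hst.2] with x hx _ _ using hx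
      · exact Eventually.of_forall fun x h1 h2 => absurd ⟨h1, h2⟩ hst
    filter_upwards [measure_eq_zero_iff_ae_notMem.1 hfull, hvis] with x hx1 hx2 hx
    have hxr : x ∈ IntervalDynamics.recurrentSet f C a b := by
      by_contra h
      exact hx1 ⟨hx, h⟩
    exact IntervalDynamics.Ioo_subset_omegaSet_of_visits hxr.2.1 fun s t h1 h2 => hx2 s t h1 h2 hxr
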